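/- **Setting.** Let $\varphi:(0,\infty)\to(0,\infty)$ satisfy: (i) $\varphi\in C^1((0,\infty))$; (ii) $(s\varphi(s))'>0$ for all $s>0$; (iii) the range of $s\mapsto s\varphi(s)$ on $(0,\infty)$ is $(0,\infty)$; (iv) there are $C_1,C_2>0$, $r>-1$ and $s_0>0$ with $C_1s^r\le (s\varphi(s))'\le C_2s^r$ for $s\in(0,s_0)$ and, if $r=0$, moreover $\lim_{s\to0^+}\varphi(s)$ exists, is finite and positive, and $\lim_{s\to0^+}s\varphi'(s)=0$; (v) there is $s_1>s_0$ such that either $\varphi'\ge0$ on $[s_1,\infty)$ or $\varphi'\le0$ on $[s_1,\infty)$; (vi) $s\mapsto|s\varphi'(s)/\varphi(s)|$ is non-decreasing on $(0,\infty)$. Define $\Lambda$ on $(0,\infty)$ by $$\Lambda\big(s\sqrt{\varphi(s)}\big)=-\frac{s\varphi'(s)}{s\varphi'(s)+2\varphi(s)}\qquad(s>0),$$ and put $\Lambda_\infty^2=\sup_{t>0}\Lambda(t)^2$. Let $\Omega\subset\mathbb R^n$ be a domain and let $\langle\cdot,\cdot\rangle$ be the Hermitian inner product of $\mathbb C^m$.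 For $m\times m$ matrices $\mathscr A^{hk}$ ($1\le h,k\le n$) with entries in $L^1_{\rm loc}(\Omega;\mathbb C)$ consider $A=\partial_h(\mathscr A^{hk}\partial_k)$ (repeated indices are summed). Let $C_c^1(\Omega)^m$ be the space of $C^1$ functions $\Omega\to\mathbb C^m$ with compact support in $\Omega$. * $A$ is *$L^\Phi$-dissipative* if $\operatorname{Re}\int_\Omega\langle\mathscr A^{hk}\partial_ku,\partial_h(\varphi(|u|)u)\rangle\,dx\ge0$ for all $u\in C^1_c(\Omega)^m$ with $\varphi(|u|)u\in C_c^1(\Omega)^m$. * $A$ is *strictly $L^\Phi$-dissipative* if there is $\kappa>0$ such that for all such $u$ $$\operatorname{Re}\int_\Omega\langle\mathscr A^{hk}\partial_ku,\partial_h(\varphi(|u|)u)\rangle\,dx\ge\kappa\int_\Omega|\nabla(\sqrt{\varphi(|u|)}\,u)|^2dx .$$ * $A$ is *integrally $\Phi$-elliptic* if there is $\kappa>0$ such that for all $v\in C_c^1(\Omega)^m$ $$\operatorname{Re}\int_\Omega\Big(\langle\mathscr A^{hk}\partial_kv,\partial_hv\rangle+\Lambda(|v|)|v|^{-2}\langle(\mathscr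 A^{hk}-(\mathscr A^{kh})^*)v,\partial_hv\rangle\operatorname{Re}\langle v,\partial_kv\rangle-\Lambda^2(|v|)|v|^{-4}\langle\mathscr A^{hk}v,v\rangle\operatorname{Re}\langle v,\partial_kv\rangle\operatorname{Re}\langle v,\partial_hv\rangle\Big)dx\ge\kappa\int_\Omega|\nabla v|^2dx,$$ the integrand on the left being extended by zero to the set where $v=0$. * $A$ is *strongly $\Phi$-elliptic* if there is $\kappa>0$ such that for almost every $x\in\Omega$ $$\operatorname{Re}\langle\mathscr A^{hk}\xi_k,\xi_h\rangle+\Lambda(t)\operatorname{Re}\langle(\mathscr A^{hk}-(\mathscr A^{kh})^*)\omega,\xi_h\rangle\operatorname{Re}\langle\omega,\xi_k\rangle-\Lambda^2(t)\operatorname{Re}\langle\mathscr A^{hk}\omega,\omega\rangle\operatorname{Re}\langle\omega,\xi_k\rangle\operatorname{Re}\langle\omega,\xi_h\rangle\ge\kappa|\xi|^2$$ for all $\xi=(\xi_1,\dots,\xi_n)\in(\mathbb C^m)^n$, all $\omega\in\mathbb C^m$ with $|\omega|=1$ and all $t>0$ (matrices evaluated at $x$). * $A$ is *weakly (Legendre–Hadamard)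 $\Phi$-elliptic* if there is $\kappa>0$ such that for almost every $x\in\Omega$, with $M=\mathscr A^{hk}(x)q_hq_k$, $$\operatorname{Re}\langle M\lambda,\lambda\rangle-\Lambda^2(t)\operatorname{Re}\langle M\omega,\omega\rangle(\operatorname{Re}\langle\lambda,\omega\rangle)^2+\Lambda(t)\operatorname{Re}\big(\langle M\omega,\lambda\rangle-\langle M\lambda,\omega\rangle\big)\operatorname{Re}\langle\lambda,\omega\rangle\ge\kappa|q|^2|\lambda|^2$$ for all $q\in\mathbb R^n$, all $\lambda,\omega\in\mathbb C^m$ with $|\omega|=1$ and all $t>0$. **Theorem.** Let $n\ge2$, let $A=\partial_h(\mathscr A^h(x)\partial_h)$, where the $\mathscr A^h$ ($1\le h\le n$) are $m\times m$ matrices with complex entries that are locally integrable in the domain $\Omega\subset\mathbb R^n$ (that is, $\mathscr A^{hk}=\delta_{hk}\mathscr A^h$), and assume $\Lambda_\infty^2<1$. The following statements are equivalent: (a) $A$ is strictly $L^\Phi$-dissipative; (b) there is $\kappa>0$ such that $A-\kappa\Delta$ (with coefficients $\delta_{hk}(\mathscr A^h-\kappa I)$) is $L^\Phi$-dissipative;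 (c) $A$ is integrally $\Phi$-elliptic; (d) $A$ is weakly $\Phi$-elliptic. Moreover, if $A$ is strongly $\Phi$-elliptic, then (a)–(d) hold. -/

import Mathlib

open MeasureTheory Set Filter Topology

/-- `ℝⁿ` with its Euclidean norm. -/
abbrev RSpace (n : ℕ) : Type := EuclideanSpace ℝ (Fin n)

/-- `ℂᵐ` with its Hermitian norm. -/
abbrev CSpace (m : ℕ) : Type := EuclideanSpace ℂ (Fin m)

/-- The standing conditions on the positive function `φ` on `(0, ∞)`;
only the values of `φ` at positive arguments matter. -/
structure AdmissiblePhi (φ : ℝ → ℝ) : Prop where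
  pos : ∀ s, 0 < s → 0 < φ s
  contDiffOn : ContDiffOn ℝ 1 φ (Ioi 0)
  deriv_pos : ∀ s, 0 < s → 0 < deriv (fun σ => σ * φ σ) s
  range_eq : (fun s => s * φ s) '' Ioi 0 = Ioi 0
  /-- The growth condition near `0` and the monotonicity of `φ` near infinity. -/
  growth : ∃ C₁ C₂ r s₀ s₁ : ℝ, 0 < C₁ ∧ 0 < C₂ ∧ -1 < r ∧ 0 < s₀ ∧ s₀ < s₁ ∧
    (∀ s ∈ Ioo 0 s₀, C₁ * s ^ r ≤ deriv (fun σ => σ * φ σ) s ∧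
      deriv (fun σ => σ * φ σ) s ≤ C₂ * s ^ r) ∧
    (r = 0 → (∃ c : ℝ, 0 < c ∧ Tendsto φ (𝓝[>] 0) (𝓝 c)) ∧
      Tendsto (fun s => s * deriv φ s) (𝓝[>] 0) (𝓝 0)) ∧
    ((∀ s, s₁ ≤ s → 0 ≤ deriv φ s) ∨ (∀ s, s₁ ≤ s → deriv φ s ≤ 0))
  monotone_abs : MonotoneOn (fun s => |s * deriv φ s / φ s|) (Ioi 0)

/-- For `t > 0`, the `s > 0` with `s √φ(s) = t` (it exists and is unique, see
`AdmissiblePhi.injOn` and `AdmissiblePhi.surjOn`). -/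
noncomputable def lamParam (φ : ℝ → ℝ) (t : ℝ) : ℝ :=
  Function.invFunOn (fun s => s * √(φ s)) (Ioi 0) t

/-- The function `Λ` on `(0, ∞)`, determined by
`Λ (s √φ(s)) = - s φ'(s) / (s φ'(s) + 2 φ(s))` for `s > 0` (see `Lam_spec`). -/
noncomputable def Lam (φ : ℝ → ℝ) (t : ℝ) : ℝ :=
  -(lamParam φ t * deriv φ (lamParam φ t) /
    (lamParam φ t * deriv φ (lamParam φ t) + 2 * φ (lamParam φ t)))

/-- `Λ_∞² = sup_{t > 0} Λ(t)²` (a supremum of numbers in `[0, 1)`, see `Lam_sq_lt_one`). -/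
noncomputable def LamInfSq (φ : ℝ → ℝ) : ℝ :=
  sSup ((fun t => Lam φ t ^ 2) '' Ioi 0)

/-- `Re ⟨x, y⟩` for the Hermitian inner product of `ℂᵐ` (symmetric in `x` and `y`, so that it does
not matter which argument is the conjugate-linear one). -/
noncomputable def reInner {m : ℕ} (x y : CSpace m) : ℝ := (inner ℂ x y).re

/-- A matrix applied to a vector of `ℂᵐ`. -/
noncomputable def matAct {m : ℕ} (M : Matrix (Fin m) (Fin m) ℂ) (v : CSpace m) : CSpace m :=
  Matrix.toEuclideanLin M v

/-- Coefficients of an operator `∂_h (𝒜^{hk}(x) ∂_k)`: the matrix `𝒜^{hk}(x)` is `T h k x`. -/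
abbrev CoeffTensor (n m : ℕ) : Type := Fin n → Fin n → RSpace n → Matrix (Fin m) (Fin m) ℂ

/-- The coefficients `δ_{hk} 𝒜^h(x)` of the operator `∂_h (𝒜^h(x) ∂_h)`. -/
def diagTensor {n m : ℕ} (a : Fin n → RSpace n → Matrix (Fin m) (Fin m) ℂ) : CoeffTensor n m :=
  fun h k x => if h = k then a h x else 0

/-- The coefficients `𝒜^{hk}(x) - κ δ_{hk} I` of the operator `A - κ Δ`. -/
noncomputable def subLaplacian {n m : ℕ} (T : CoeffTensor n m) (κ : ℝ) : CoeffTensor n m :=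
  fun h k x => T h k x - if h = k then (κ : ℂ) • (1 : Matrix (Fin m) (Fin m) ℂ) else 0

/-- The partial derivative `∂_h u (x)`. -/
noncomputable def pd {n m : ℕ} (h : Fin n) (u : RSpace n → CSpace m) (x : RSpace n) : CSpace m :=
  fderiv ℝ u x (EuclideanSpace.single h 1)

/-- `|∇u(x)|²`. -/
noncomputable def gradSq {n m : ℕ} (u : RSpace n → CSpace m) (x : RSpace n) : ℝ :=
  ∑ h, ‖pd h u x‖ ^ 2

/-- Membership in `[C_c¹(Ω)]ᵐ`; functions on `Ω` with compact support in `Ω` are extended by zero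
to `ℝⁿ`. -/
def IsTest {n m : ℕ} (Ω : Set (RSpace n)) (u : RSpace n → CSpace m) : Prop :=
  ContDiff ℝ 1 u ∧ HasCompactSupport u ∧ tsupport u ⊆ Ω

/-- `φ(|u|) u`, which is `0` where `u` vanishes. -/
noncomputable def phiMul {n m : ℕ} (φ : ℝ → ℝ) (u : RSpace n → CSpace m) :
    RSpace n → CSpace m :=
  fun x => φ ‖u x‖ • u x

/-- `√φ(|u|) u`, which is `0` where `u` vanishes. -/
noncomputable def sqrtPhiMul {n m : ℕ} (φ : ℝ → ℝ) (u : RSpace n → CSpace m) :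
    RSpace n → CSpace m :=
  fun x => √(φ ‖u x‖) • u x

/-- `Re ∫_Ω ⟨𝒜^{hk} ∂_k u, ∂_h w⟩ dx`. -/
noncomputable def energy {n m : ℕ} (Ω : Set (RSpace n)) (T : CoeffTensor n m)
    (u w : RSpace n → CSpace m) : ℝ :=
  ∫ x in Ω, ∑ h, ∑ k, reInner (matAct (T h k x) (pd k u x)) (pd h w x)

/-- `L^Φ`-dissipativity of the operator `∂_h (𝒜^{hk} ∂_k)` in `Ω`. -/
def PhiDissipative {n m : ℕ} (φ : ℝ → ℝ) (Ω : Set (RSpace n)) (T : CoeffTensor n m) : Prop :=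
  ∀ u : RSpace n → CSpace m, IsTest Ω u → IsTest Ω (phiMul φ u) →
    0 ≤ energy Ω T u (phiMul φ u)

/-- Strict `L^Φ`-dissipativity of the operator `∂_h (𝒜^{hk} ∂_k)` in `Ω`. -/
def StrictPhiDissipative {n m : ℕ} (φ : ℝ → ℝ) (Ω : Set (RSpace n)) (T : CoeffTensor n m) :
    Prop :=
  ∃ κ : ℝ, 0 < κ ∧ ∀ u : RSpace n → CSpace m, IsTest Ω u → IsTest Ω (phiMul φ u) →
    κ * (∫ x in Ω, gradSq (sqrtPhiMul φ u) x) ≤ energy Ω T u (phiMul φ u)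

/-- The real part of the integrand
`⟨𝒜^{hk} ∂_k v, ∂_h v⟩ + Λ(|v|) |v|⁻² ⟨(𝒜^{hk} - (𝒜^{kh})*) v, ∂_h v⟩ Re ⟨v, ∂_k v⟩
 - Λ(|v|)² |v|⁻⁴ ⟨𝒜^{hk} v, v⟩ Re ⟨v, ∂_k v⟩ Re ⟨v, ∂_h v⟩`,
extended by zero to the set where `v` vanishes. -/
noncomputable def phiIntegrand {n m : ℕ} (φ : ℝ → ℝ) (T : CoeffTensor n m)
    (v : RSpace n → CSpace m) (x : RSpace n) : ℝ :=
  {y | v y ≠ 0}.indicator (fun x => ∑ h, ∑ k,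
    (reInner (matAct (T h k x) (pd k v x)) (pd h v x)
      + Lam φ ‖v x‖ * (‖v x‖ ^ 2)⁻¹ *
          reInner (matAct (T h k x - (T k h x).conjTranspose) (v x)) (pd h v x) *
          reInner (v x) (pd k v x)
      - Lam φ ‖v x‖ ^ 2 * (‖v x‖ ^ 4)⁻¹ * reInner (matAct (T h k x) (v x)) (v x) *
          reInner (v x) (pd k v x) * reInner (v x) (pd h v x))) x

/-- The integral `Φ`-ellipticity condition. -/
def IntegralPhiElliptic {n m : ℕ} (φ : ℝ → ℝ) (Ω : Set (RSpace n)) (T : CoeffTensor n m) :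
    Prop :=
  ∃ κ : ℝ, 0 < κ ∧ ∀ v : RSpace n → CSpace m, IsTest Ω v →
    κ * (∫ x in Ω, gradSq v x) ≤ ∫ x in Ω, phiIntegrand φ T v x

/-- The strong `Φ`-ellipticity condition. -/
def StrongPhiElliptic {n m : ℕ} (φ : ℝ → ℝ) (Ω : Set (RSpace n)) (T : CoeffTensor n m) : Prop :=
  ∃ κ : ℝ, 0 < κ ∧ ∀ᵐ x ∂(volume.restrict Ω),
    ∀ (ξ : Fin n → CSpace m) (ω : CSpace m) (t : ℝ), ‖ω‖ = 1 → 0 < t →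
      κ * (∑ h, ‖ξ h‖ ^ 2) ≤ ∑ h, ∑ k,
        (reInner (matAct (T h k x) (ξ k)) (ξ h)
          + Lam φ t * reInner (matAct (T h k x - (T k h x).conjTranspose) ω) (ξ h) *
              reInner ω (ξ k)
          - Lam φ t ^ 2 * reInner (matAct (T h k x) ω) ω * reInner ω (ξ k) * reInner ω (ξ h))

/-- The symbol `𝒜^{hk}(x) q_h q_k`. -/
noncomputable def symbolMatrix {n m : ℕ} (T : CoeffTensor n m) (x q : RSpace n) :
    Matrix (Fin m) (Fin m) ℂ :=
  ∑ h, ∑ k, ((q h * q k : ℝ) : ℂ) • T h k x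

/-- The weak (Legendre–Hadamard) `Φ`-ellipticity condition. -/
def WeakPhiElliptic {n m : ℕ} (φ : ℝ → ℝ) (Ω : Set (RSpace n)) (T : CoeffTensor n m) : Prop :=
  ∃ κ : ℝ, 0 < κ ∧ ∀ᵐ x ∂(volume.restrict Ω),
    ∀ (q : RSpace n) (ξ ω : CSpace m) (t : ℝ), ‖ω‖ = 1 → 0 < t →
      κ * ‖q‖ ^ 2 * ‖ξ‖ ^ 2 ≤
        reInner (matAct (symbolMatrix T x q) ξ) ξ
          - Lam φ t ^ 2 * reInner (matAct (symbolMatrix T x q) ω) ω * reInner ξ ω ^ 2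
          + Lam φ t * (reInner (matAct (symbolMatrix T x q) ω) ξ
              - reInner (matAct (symbolMatrix T x q) ξ) ω) * reInner ξ ω

/-- The substitution `s ↦ s √φ(s)` is one-to-one on `(0, ∞)`. -/
theorem AdmissiblePhi.injOn {φ : ℝ → ℝ} (hφ : AdmissiblePhi φ) :
    InjOn (fun s => s * √(φ s)) (Ioi 0) := by
  have hmono : StrictMonoOn (fun s => s * φ s) (Ioi 0) := by
    apply strictMonoOn_of_deriv_pos (convex_Ioi 0)
    · exact continuousOn_id.mul hφ.contDiffOn.continuousOn
    · intro s hs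
      rw [interior_Ioi] at hs
      exact hφ.deriv_pos s hs
  have hs : StrictMonoOn (fun s => s * √(φ s)) (Ioi 0) := by
    intro a ha b hb hab
    have ha' : 0 < a := ha
    have hb' : 0 < b := hb
    have h1 : a * φ a < b * φ b := hmono ha hb hab
    have h0 : 0 < a * φ a := mul_pos ha' (hφ.pos a ha')
    have h2 : a * (a * φ a) < b * (b * φ b) := mul_lt_mul'' hab h1 ha'.le h0.le
    have e : ∀ c, 0 < c → (c * √(φ c)) ^ 2 = c * (c * φ c) := fun c hc => by
      rw [mul_pow, Real.sq_sqrt (hφ.pos c hc).le]; ring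
    refine lt_of_pow_lt_pow_left₀ 2 (by positivity) ?_
    simpa only [e a ha', e b hb'] using h2
  exact hs.injOn

/-- The substitution `s ↦ s √φ(s)` maps `(0, ∞)` onto `(0, ∞)`. -/
theorem AdmissiblePhi.surjOn {φ : ℝ → ℝ} (hφ : AdmissiblePhi φ) :
    SurjOn (fun s => s * √(φ s)) (Ioi 0) (Ioi 0) := by
  have hcφ := hφ.contDiffOn.continuousOn
  have hmono : StrictMonoOn (fun s => s * φ s) (Ioi 0) := by
    apply strictMonoOn_of_deriv_pos (convex_Ioi 0)
    · exact continuousOn_id.mul hcφ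
    · intro s hs
      rw [interior_Ioi] at hs
      exact hφ.deriv_pos s hs
  have hc : ContinuousOn (fun s => s * √(φ s)) (Ioi 0) := continuousOn_id.mul hcφ.sqrt
  intro t ht
  have ht' : (0 : ℝ) < t := ht
  have e : ∀ c, 0 < c → (c * √(φ c)) ^ 2 = c * (c * φ c) := fun c hc => by
    rw [mul_pow, Real.sq_sqrt (hφ.pos c hc).le]; ring
  have h1 : ∃ a ∈ Ioi (0 : ℝ), a * √(φ a) ≤ t := by
    obtain ⟨p, hp, hpt⟩ : t ∈ (fun s => s * φ s) '' Ioi 0 := by rw [hφ.range_eq]; exact ht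
    have hp' : (0 : ℝ) < p := hp
    refine ⟨min p t, lt_min hp' ht', ?_⟩
    have hm : 0 < min p t := lt_min hp' ht'
    refine (sq_le_sq₀ (by positivity) ht'.le).1 ?_
    rw [e _ hm, sq]
    exact mul_le_mul (min_le_right _ _)
      ((hmono.monotoneOn hm hp (min_le_left _ _)).trans_eq hpt)
      (mul_pos hm (hφ.pos _ hm)).le ht'.le
  have h2 : ∃ b ∈ Ioi (0 : ℝ), t ≤ b * √(φ b) := by
    obtain ⟨p, hp, hpt⟩ : t ∈ (fun s => s * φ s) '' Ioi 0 := by rw [hφ.range_eq]; exact ht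
    have hp' : (0 : ℝ) < p := hp
    have hm : 0 < max p t := lt_max_of_lt_left hp'
    refine ⟨max p t, hm, ?_⟩
    refine (sq_le_sq₀ ht'.le (by positivity)).1 ?_
    rw [e _ hm, sq]
    exact mul_le_mul (le_max_right _ _)
      (hpt.symm.trans_le (hmono.monotoneOn hp hm (le_max_left _ _))) ht'.le hm.le
  obtain ⟨a, ha, hat⟩ := h1
  obtain ⟨b, hb, hbt⟩ := h2
  exact isPreconnected_Ioi.intermediate_value ha hb hc ⟨hat, hbt⟩

/-- The relation that determines `Λ`. -/
theorem Lam_spec {φ : ℝ → ℝ} (hφ : AdmissiblePhi φ) {s : ℝ} (hs : 0 < s) :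
    Lam φ (s * √(φ s)) = -(s * deriv φ s / (s * deriv φ s + 2 * φ s)) := by
  have h : lamParam φ (s * √(φ s)) = s :=
    hφ.injOn.leftInvOn_invFunOn (show s ∈ Ioi (0 : ℝ) from hs)
  rw [Lam, h]

/-- All values of `Λ` on `(0, ∞)` lie in `(-1, 1)`. -/
theorem Lam_sq_lt_one {φ : ℝ → ℝ} (hφ : AdmissiblePhi φ) {t : ℝ} (ht : 0 < t) :
    Lam φ t ^ 2 < 1 := by
  obtain ⟨s, hs, rfl⟩ := hφ.surjOn (show t ∈ Ioi (0 : ℝ) from ht)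
  have hs' : 0 < s := hs
  have hp := hφ.pos s hs'
  have hd := hφ.deriv_pos s hs'
  have hdiff : DifferentiableAt ℝ φ s :=
    (hφ.contDiffOn.differentiableOn (by norm_num)).differentiableAt (Ioi_mem_nhds hs')
  have hder : deriv (fun σ => σ * φ σ) s = φ s + s * deriv φ s := by
    have := ((hasDerivAt_id' s).fun_mul hdiff.hasDerivAt).deriv
    simpa using this
  rw [hder] at hd
  change Lam φ (s * √(φ s)) ^ 2 < 1
  rw [Lam_spec hφ hs', neg_sq, div_pow, div_lt_one (by nlinarith)]
  nlinarith

/-! Everything reduces to a pointwise condition on each matrix separately. For `v = √φ(|u|) u`, off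
the zeros of `u`, the density `Re ⟨𝒜^h ∂_h u, ∂_h(φ(|u|) u)⟩` equals `phiForm` evaluated at
`Λ(|v|)`, `v/|v|` and `∂_h v` (`reInner_matAct_radialDeriv`); this identity is the reason for the
definition of `Λ`. Almost everywhere on the zero set of a `C¹` function its gradient vanishes
(`ae_fderiv_eq_zero_of_eq_zero`), so that set contributes nothing. The pivot is `DiagPhiElliptic`: a
uniform lower bound on `phiForm` for every `𝒜^h`. It is the weak condition, because the symbol of a
diagonal operator is `∑ q_h² 𝒜^h`. Integrating the bound gives (a), (b) and (c).

Conversely, each of (a), (b), (c) gives dissipativity of `A - κΔ` on the restricted class where `u`,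
`φ(|u|) u` and `√φ(|u|) u` are all `C¹`. Such functions are tested in the form `U₀ + p ζ` near the
support of a given `ψ`, with `p` a wave in the variable `x_h` of small amplitude and large gradient.
After division by the squared gradient size, and summation over two phases so that `sin² + cos² = 1`
removes the oscillation, the limit is `∫ ψ² Re ⟨(𝒜^h - κI) ζ, D(φ(|U|)U)(U₀)ζ⟩ ≥ 0`
(`RegularPhiDissipative.integral_sq_mul_nonneg`). Since `ψ` is arbitrary, the integrand is
nonnegative almost everywhere. A countable dense set of pairs `(U₀, ζ)` makes the null set uniform,
and every triple `(ω, t, ξ)` comes from some pair (`exists_radialDeriv_eq`). The assumption `Λ_∞² <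
1` turns `κ(|ξ|² - Λ²(Re ⟨ω, ξ⟩)²)` into a multiple of `|ξ|²`.

The constant `U₀` has to be cut off to zero inside the restricted class although `φ` may be singular
or degenerate at the origin; `AdmissiblePhi.exists_profile` supplies the radial profile. -/

/-! ### Zero sets, localization of integrals, and a one-variable smoothness criterion. -/

/-- The simple zeros of a curve form a countable set. -/
theorem countable_zeros_deriv_ne_zero {F : Type*} [NormedAddCommGroup F] [NormedSpace ℝ F]
    (g : ℝ → F) : {t | g t = 0 ∧ DifferentiableAt ℝ g t ∧ deriv g t ≠ 0}.Countable := by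
  set S := {t | g t = 0 ∧ DifferentiableAt ℝ g t ∧ deriv g t ≠ 0} with hS
  -- A nonzero derivative isolates the zero, and a discrete subspace of the line is countable.
  have : DiscreteTopology S := by
    rw [discreteTopology_subtype_iff]
    rintro t ⟨-, hd, hne⟩
    have h := hd.hasDerivAt.eventually_ne (c := (0 : F)) hne
    rw [← disjoint_iff, disjoint_principal_right]
    filter_upwards [h] with z hz hzS
    exact hz hzS.1
  exact TopologicalSpace.separableSpace_iff_countable.1 inferInstance

/-- The derivative of a `C¹` map vanishes almost everywhere on its zero set. -/
theorem ae_fderiv_eq_zero_of_eq_zero {E F : Type*} [NormedAddCommGroup E] [NormedSpace ℝ E]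
    [FiniteDimensional ℝ E] [MeasurableSpace E] [BorelSpace E] (μ : Measure E)
    [μ.IsAddHaarMeasure] [NormedAddCommGroup F] [NormedSpace ℝ F] {u : E → F}
    (hu : ContDiff ℝ 1 u) : ∀ᵐ x ∂μ, u x = 0 → fderiv ℝ u x = 0 := by
  have hdir : ∀ w : E, ∀ᵐ x ∂μ, u x = 0 → fderiv ℝ u x w = 0 := by
    intro w
    let L : ℝ →L[ℝ] E := ContinuousLinearMap.toSpanSingleton ℝ w
    -- Fubini: it suffices to check almost every point on each line parallel to `w`.
    refine ae_mem_of_ae_add_linearMap_mem (s := {x | u x = 0 → fderiv ℝ u x w = 0})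
      L.toLinearMap volume μ ?_ fun y => ?_
    · have h1 : IsClosed {x | u x = 0} := isClosed_eq hu.continuous continuous_const
      have h2 : IsClosed {x | fderiv ℝ u x w = 0} :=
        isClosed_eq ((hu.continuous_fderiv (by norm_num)).clm_apply continuous_const)
          continuous_const
      have : {x | u x = 0 → fderiv ℝ u x w = 0} = {x | u x = 0}ᶜ ∪ {x | fderiv ℝ u x w = 0} := by
        ext x; simp [imp_iff_not_or]
      rw [this]
      exact h1.measurableSet.compl.union h2.measurableSet
    · have hc := (countable_zeros_deriv_ne_zero fun t : ℝ => u (y + t • w)).ae_notMem volume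
      filter_upwards [hc] with t ht h0
      have hline : HasDerivAt (fun t : ℝ => y + t • w) w t := by
        simpa using ((hasDerivAt_id t).smul_const w).const_add y
      have hd : HasDerivAt (fun t : ℝ => u (y + t • w)) (fderiv ℝ u (y + t • w) w) t :=
        ((hu.differentiable (by norm_num)) _).hasFDerivAt.comp_hasDerivAt t hline
      by_contra hne
      exact ht ⟨h0, hd.differentiableAt, by rw [hd.deriv]; exact hne⟩
  let b := Module.finBasis ℝ E
  filter_upwards [ae_all_iff.2 fun i => hdir (b i)] with x hx h0
  have : (fderiv ℝ u x : E →ₗ[ℝ] F) = 0 := b.ext fun i => by simpa using hx i h0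
  ext w
  simpa using congrArg (fun l => l w) this

/-- A function whose integrals against squares of test functions are nonnegative is nonnegative
almost everywhere. -/
theorem ae_nonneg_of_integral_sq_mul_nonneg {E : Type*} [NormedAddCommGroup E] [NormedSpace ℝ E]
    [FiniteDimensional ℝ E] [MeasurableSpace E] [BorelSpace E] {μ : Measure E}
    [IsFiniteMeasureOnCompacts μ] [μ.InnerRegular]
    {Ω : Set E} (hΩ : IsOpen Ω) {f : E → ℝ} (hf : LocallyIntegrableOn f Ω μ)
    (h : ∀ ψ : E → ℝ, ContDiff ℝ 1 ψ → HasCompactSupport ψ → tsupport ψ ⊆ Ω →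
      0 ≤ ∫ x in Ω, ψ x ^ 2 * f x ∂μ) :
    ∀ᵐ x ∂(μ.restrict Ω), 0 ≤ f x := by
  have hint : ∀ K, IsCompact K → K ⊆ Ω → IntegrableOn f K μ := fun K hK hKΩ =>
    hf.integrableOn_compact_subset hKΩ hK
  have hcomp : ∀ K, IsCompact K → K ⊆ Ω → 0 ≤ ∫ x in K, f x ∂μ := by
    intro K hK hKΩ
    obtain ⟨δ, δpos, hδ⟩ := hK.exists_cthickening_subset_open hΩ hKΩ
    have hK' : IsCompact (Metric.cthickening δ K) := hK.cthickening
    obtain ⟨w, -, w_pos, w_lim⟩ := exists_seq_strictAnti_tendsto' δpos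
    have hex : ∀ j : ℕ, ∃ g : E → ℝ, Function.support g = Metric.thickening (w j) K ∧
        ContDiff ℝ 1 g ∧ Set.range g ⊆ Set.Icc 0 1 ∧ ∀ x ∈ K, g x = 1 := by
      intro j
      obtain ⟨g, h1, h2, h3, h4⟩ := exists_contMDiff_support_eq_eq_one_iff (n := 1)
        (modelWithCornersSelf ℝ E) (Metric.isOpen_thickening (δ := w j) (E := K)) hK.isClosed
        (Metric.self_subset_thickening (w_pos j).1 K)
      exact ⟨g, h3, h1.contDiff, h2, fun x hx => (h4 x).1 hx⟩
    choose g g_supp g_diff g_range hg using hex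
    have hsub : ∀ j, Metric.thickening (w j) K ⊆ Metric.cthickening δ K := fun j =>
      (Metric.thickening_mono (w_pos j).2.le K).trans (Metric.thickening_subset_cthickening δ K)
    have hts : ∀ j, tsupport (g j) ⊆ Metric.cthickening δ K := fun j =>
      closure_minimal (by rw [g_supp]; exact hsub j) Metric.isClosed_cthickening
    -- The cutoffs equal `1` on `K` and are supported in thickenings shrinking to `K`, so their
    -- squares tend to the indicator of `K`.
    have hlim : Tendsto (fun j => ∫ x in Ω, g j x ^ 2 * f x ∂μ) atTop
        (𝓝 (∫ x in Ω, K.indicator f x ∂μ)) := by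
      refine tendsto_integral_of_dominated_convergence
        ((Metric.cthickening δ K).indicator fun x => ‖f x‖) (fun j => ?_) ?_ (fun j => ?_) ?_
      · exact (((g_diff j).continuous.pow 2).aestronglyMeasurable).mul
          (hf.aestronglyMeasurable)
      · exact ((integrable_indicator_iff hK'.measurableSet).2
          (hint _ hK' hδ).norm).mono_measure Measure.restrict_le_self
      · refine Eventually.of_forall fun x => ?_
        have hr := g_range j ⟨x, rfl⟩
        by_cases hx : x ∈ Metric.cthickening δ K
        · rw [indicator_of_mem hx, norm_mul, Real.norm_of_nonneg (by positivity)]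
          exact mul_le_of_le_one_left (norm_nonneg _) (pow_le_one₀ hr.1 hr.2)
        · have : g j x = 0 := by
            rw [← Function.notMem_support, g_supp]
            exact fun hh => hx (hsub j hh)
          simp [this, hx]
      · refine Eventually.of_forall fun x => ?_
        by_cases hx : x ∈ K
        · simp [hg _ x hx, hx]
        · rw [indicator_of_notMem hx]
          apply tendsto_const_nhds.congr'
          obtain ⟨ε, εpos, hε⟩ : ∃ ε, 0 < ε ∧ x ∉ Metric.thickening ε K := by
            rw [← hK.isClosed.closure_eq, Metric.closure_eq_iInter_thickening K] at hx
            simpa using hx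
          filter_upwards [(tendsto_order.1 w_lim).2 _ εpos] with j hj
          have : g j x = 0 := by
            rw [← Function.notMem_support, g_supp]
            exact fun hh => hε (Metric.thickening_mono hj.le K hh)
          simp [this]
    rw [integral_indicator hK.measurableSet, Measure.restrict_restrict hK.measurableSet,
      inter_eq_left.2 hKΩ] at hlim
    exact ge_of_tendsto' hlim fun j => h _ (g_diff j)
      (HasCompactSupport.of_support_subset_isCompact hK' (by rw [g_supp]; exact hsub j))
      ((hts j).trans hδ)
  have hmeas : AEStronglyMeasurable f (μ.restrict Ω) := hf.aestronglyMeasurable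
  set f' := hmeas.mk f with hf'
  have hff' := hmeas.ae_eq_mk
  have hNm : MeasurableSet ({x | f' x < 0} ∩ Ω) :=
    (hmeas.stronglyMeasurable_mk.measurable measurableSet_Iio).inter hΩ.measurableSet
  have hN : μ ({x | f' x < 0} ∩ Ω) = 0 := by
    by_contra hne
    -- Inner regularity: if `f` were negative on a set of positive measure, its integral over some
    -- compact part would be negative.
    obtain ⟨K, hKN, hK, hKpos⟩ := hNm.exists_lt_isCompact (pos_iff_ne_zero.2 hne)
    have hKΩ : K ⊆ Ω := fun x hx => (hKN hx).2
    have heq : f =ᵐ[μ.restrict K] f' := ae_restrict_of_ae_restrict_of_subset hKΩ hff'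
    have h0 := hcomp K hK hKΩ
    rw [integral_congr_ae heq] at h0
    have hi : IntegrableOn f' K μ := (hint K hK hKΩ).congr heq
    have hpos : 0 < ∫ x in K, -f' x ∂μ := by
      rw [setIntegral_pos_iff_support_of_nonneg_ae (f := fun x => -f' x) ?_ hi.neg]
      · refine hKpos.trans_le (measure_mono fun x hx => ⟨?_, hx⟩)
        have : f' x < 0 := (hKN hx).1
        simpa using this.ne
      · filter_upwards [ae_restrict_mem hK.measurableSet] with x hx
        have : f' x < 0 := (hKN hx).1
        simpa using this.le
    rw [integral_neg] at hpos
    linarith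
  have hN' : μ.restrict Ω {x | f' x < 0} = 0 := by
    rw [← hN]
    exact Measure.restrict_apply (hmeas.stronglyMeasurable_mk.measurable measurableSet_Iio)
  filter_upwards [hff', measure_eq_zero_iff_ae_notMem.1 hN'] with x h1 h2
  rw [h1]
  simpa using h2

/-- If `K` and `K'` are bounded on `(0, ∞)` by the identity and a constant, then `τ ↦ K (c τ²)` is
continuously differentiable on the line. -/
theorem contDiff_comp_mul_sq {K K' : ℝ → ℝ} {c : ℝ} (hc : 0 < c) (hK0 : K 0 = 0)
    (hK : ∀ y, 0 < y → HasDerivAt K (K' y) y) (hK' : ContinuousOn K' (Ioi 0))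
    (hb : ∀ y, 0 < y → |K y| ≤ y) (hb' : ∀ y, 0 < y → |K' y| ≤ 1) :
    ContDiff ℝ 1 fun τ => K (c * τ ^ 2) := by
  have hpos : ∀ τ : ℝ, τ ≠ 0 → 0 < c * τ ^ 2 := fun τ hτ => by positivity
  have hd : ∀ τ, HasDerivAt (fun τ => K (c * τ ^ 2))
      (if τ = 0 then 0 else K' (c * τ ^ 2) * (c * (2 * τ))) τ := by
    intro τ
    split_ifs with h
    · subst h
      rw [hasDerivAt_iff_isLittleO_nhds_zero]
      -- The square in the argument makes the function `O(h²)`, hence flat at the origin without any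
      -- regularity of `K` there.
      have h1 : (fun h : ℝ => K (c * (0 + h) ^ 2) - K (c * 0 ^ 2) - h • (0 : ℝ)) =O[𝓝 0]
          fun h => h ^ 2 := by
        refine Asymptotics.IsBigO.of_bound c (Eventually.of_forall fun h => ?_)
        rcases eq_or_ne h 0 with rfl | hh
        · simp
        · have := hb _ (hpos h hh)
          simpa [hK0] using this
      refine h1.trans_isLittleO ?_
      simpa using Asymptotics.isLittleO_pow_pow (𝕜 := ℝ) (m := 1) (n := 2) (by norm_num)
    · have h2 : HasDerivAt (fun τ : ℝ => c * τ ^ 2) (c * (2 * τ)) τ := by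
        simpa using (hasDerivAt_pow 2 τ).const_mul c
      exact (hK _ (hpos τ h)).comp τ h2
  rw [contDiff_one_iff_deriv]
  refine ⟨fun τ => (hd τ).differentiableAt, ?_⟩
  rw [show deriv (fun τ => K (c * τ ^ 2)) = fun τ => if τ = 0 then 0 else
    K' (c * τ ^ 2) * (c * (2 * τ)) from funext fun τ => (hd τ).deriv]
  rw [continuous_iff_continuousAt]
  intro τ
  rcases eq_or_ne τ 0 with rfl | h
  · have hlim : Tendsto (fun τ : ℝ => c * (2 * |τ|)) (𝓝 0) (𝓝 0) := by
      have : Continuous fun τ : ℝ => c * (2 * |τ|) := by fun_prop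
      simpa using this.tendsto 0
    rw [ContinuousAt, if_pos rfl]
    refine squeeze_zero_norm (fun τ => ?_) hlim
    split_ifs with h
    · simp only [norm_zero]; positivity
    · rw [norm_mul, Real.norm_eq_abs, Real.norm_eq_abs, abs_mul, abs_mul, abs_of_pos hc, abs_two]
      exact mul_le_of_le_one_left (by positivity) (hb' _ (hpos τ h))
  · have : (fun τ => K' (c * τ ^ 2) * (c * (2 * τ))) =ᶠ[𝓝 τ]
        fun τ => if τ = 0 then 0 else K' (c * τ ^ 2) * (c * (2 * τ)) := by
      filter_upwards [isOpen_ne.mem_nhds h] with σ hσ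
      rw [if_neg hσ]
    refine ContinuousAt.congr ?_ this
    have h1 : ContinuousAt K' (c * τ ^ 2) := hK'.continuousAt (Ioi_mem_nhds (hpos τ h))
    have h2 : ContinuousAt (fun τ : ℝ => c * τ ^ 2) τ := by fun_prop
    exact (ContinuousAt.comp (f := fun τ : ℝ => c * τ ^ 2) h1 h2).mul (by fun_prop)

/-! ### The real inner product and the quadratic form `phiForm`. -/

section Algebra

variable {m : ℕ}

theorem reInner_eq_inner_real (x y : CSpace m) : reInner x y = inner ℝ x y := by
  simp [reInner, PiLp.inner_apply]

theorem reInner_comm (x y : CSpace m) : reInner x y = reInner y x := by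
  simp only [reInner_eq_inner_real]; exact real_inner_comm _ _

theorem reInner_add_left (x y z : CSpace m) : reInner (x + y) z = reInner x z + reInner y z := by
  simp only [reInner_eq_inner_real, inner_add_left]

theorem reInner_add_right (x y z : CSpace m) : reInner x (y + z) = reInner x y + reInner x z := by
  simp only [reInner_eq_inner_real, inner_add_right]

theorem reInner_sub_left (x y z : CSpace m) : reInner (x - y) z = reInner x z - reInner y z := by
  simp only [reInner_eq_inner_real, inner_sub_left]

theorem reInner_sub_right (x y z : CSpace m) : reInner x (y - z) = reInner x y - reInner x z := by
  simp only [reInner_eq_inner_real, inner_sub_right]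

theorem reInner_smul_left (c : ℝ) (x y : CSpace m) : reInner (c • x) y = c * reInner x y := by
  simp only [reInner_eq_inner_real, real_inner_smul_left]

theorem reInner_smul_right (c : ℝ) (x y : CSpace m) : reInner x (c • y) = c * reInner x y := by
  simp only [reInner_eq_inner_real, real_inner_smul_right]

theorem reInner_self (x : CSpace m) : reInner x x = ‖x‖ ^ 2 := by
  simp only [reInner_eq_inner_real, real_inner_self_eq_norm_sq]

theorem abs_reInner_le (x y : CSpace m) : |reInner x y| ≤ ‖x‖ * ‖y‖ := by
  simp only [reInner_eq_inner_real]; exact abs_real_inner_le_norm _ _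

@[simp] theorem reInner_zero_left (x : CSpace m) : reInner 0 x = 0 := by
  simp [reInner_eq_inner_real]

@[simp] theorem reInner_zero_right (x : CSpace m) : reInner x 0 = 0 := by
  simp [reInner_eq_inner_real]

theorem continuous_reInner : Continuous fun p : CSpace m × CSpace m => reInner p.1 p.2 := by
  simp only [reInner_eq_inner_real]; fun_prop

theorem matAct_add (M : Matrix (Fin m) (Fin m) ℂ) (x y : CSpace m) :
    matAct M (x + y) = matAct M x + matAct M y := by simp [matAct]

theorem matAct_smul (M : Matrix (Fin m) (Fin m) ℂ) (c : ℝ) (x : CSpace m) :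
    matAct M (c • x) = c • matAct M x := by
  rw [matAct, matAct, ← Complex.coe_smul, map_smul, Complex.coe_smul]

@[simp] theorem matAct_zero (M : Matrix (Fin m) (Fin m) ℂ) : matAct M 0 = 0 := by simp [matAct]

@[simp] theorem matAct_zero_matrix (x : CSpace m) : matAct 0 x = 0 := by simp [matAct]

theorem matAct_sub_matrix (M N : Matrix (Fin m) (Fin m) ℂ) (x : CSpace m) :
    matAct (M - N) x = matAct M x - matAct N x := by simp [matAct]

theorem matAct_sum_matrix {ι : Type*} (s : Finset ι) (M : ι → Matrix (Fin m) (Fin m) ℂ)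
    (x : CSpace m) : matAct (∑ i ∈ s, M i) x = ∑ i ∈ s, matAct (M i) x := by
  simp [matAct]

theorem matAct_real_smul_matrix (c : ℝ) (M : Matrix (Fin m) (Fin m) ℂ) (x : CSpace m) :
    matAct ((c : ℂ) • M) x = c • matAct M x := by
  rw [matAct, map_smul, LinearMap.smul_apply, Complex.coe_smul, matAct]

@[simp] theorem matAct_one (x : CSpace m) : matAct 1 x = x := by
  ext i; simp [matAct]

theorem continuous_matAct (M : Matrix (Fin m) (Fin m) ℂ) : Continuous (matAct M) :=
  LinearMap.continuous_of_finiteDimensional (Matrix.toEuclideanLin M)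

theorem reInner_matAct_conjTranspose (M : Matrix (Fin m) (Fin m) ℂ) (x y : CSpace m) :
    reInner (matAct M.conjTranspose x) y = reInner (matAct M y) x := by
  rw [reInner_comm, reInner, matAct, Matrix.toEuclideanLin_conjTranspose_eq_adjoint,
    LinearMap.adjoint_inner_right]
  rfl

/-- The matrix entries determine the form `Re ⟨M x, y⟩`. -/
theorem reInner_matAct_eq_sum (M : Matrix (Fin m) (Fin m) ℂ) (x y : CSpace m) :
    reInner (matAct M x) y = ∑ i, ∑ j, (M i j * x j * (starRingEnd ℂ) (y i)).re := by
  rw [reInner_comm, reInner]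
  simp [PiLp.inner_apply, matAct, Matrix.toLpLin_apply, Matrix.mulVec, dotProduct,
    Finset.sum_mul]

/-- The quadratic form `Re ⟨A (ξ + Λ r ω), ξ - Λ r ω⟩`, where `r = Re ⟨ω, ξ⟩`. -/
noncomputable def phiForm (A : Matrix (Fin m) (Fin m) ℂ) (l : ℝ) (ω ξ : CSpace m) : ℝ :=
  reInner (matAct A (ξ + (l * reInner ω ξ) • ω)) (ξ - (l * reInner ω ξ) • ω)

theorem phiForm_expand (A : Matrix (Fin m) (Fin m) ℂ) (l : ℝ) (ω ξ : CSpace m) :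
    phiForm A l ω ξ = reInner (matAct A ξ) ξ
      + l * (reInner (matAct A ω) ξ - reInner (matAct A ξ) ω) * reInner ω ξ
      - l ^ 2 * reInner (matAct A ω) ω * reInner ω ξ ^ 2 := by
  simp only [phiForm, matAct_add, matAct_smul, reInner_add_left, reInner_sub_right,
    reInner_smul_left, reInner_smul_right]
  ring

/-- For a single matrix the adjoint term of the integrand turns into `Re ⟨A ξ, ω⟩`, which completes
the product form. -/
theorem phiForm_expand_conjTranspose (A : Matrix (Fin m) (Fin m) ℂ) (l : ℝ) (ω ξ : CSpace m) :
    reInner (matAct A ξ) ξ + l * reInner (matAct (A - A.conjTranspose) ω) ξ * reInner ω ξ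
      - l ^ 2 * reInner (matAct A ω) ω * reInner ω ξ * reInner ω ξ = phiForm A l ω ξ := by
  rw [phiForm_expand, matAct_sub_matrix, reInner_sub_left, reInner_matAct_conjTranspose]
  ring

/-- The Laplacian itself contributes `|ξ|² - l² (Re ⟨ω, ξ⟩)²`, which is at most `|ξ|²`. Passing
between strict dissipativity and dissipativity of `A - κΔ` rests on this. -/
theorem phiForm_sub_smul_one (A : Matrix (Fin m) (Fin m) ℂ) (κ l : ℝ) {ω : CSpace m}
    (hω : ‖ω‖ = 1) (ξ : CSpace m) :
    phiForm (A - (κ : ℂ) • 1) l ω ξ =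
      phiForm A l ω ξ - κ * (‖ξ‖ ^ 2 - l ^ 2 * reInner ω ξ ^ 2) := by
  simp only [phiForm_expand, matAct_sub_matrix, matAct_real_smul_matrix, matAct_one,
    reInner_sub_left, reInner_smul_left, reInner_self, hω, reInner_comm ξ ω]
  ring

theorem phiForm_one_bounds (l : ℝ) {ω : CSpace m} (hω : ‖ω‖ = 1) (ξ : CSpace m) :
    (1 - l ^ 2) * ‖ξ‖ ^ 2 ≤ ‖ξ‖ ^ 2 - l ^ 2 * reInner ω ξ ^ 2 := by
  have h := abs_reInner_le ω ξ
  rw [hω, one_mul] at h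
  have := pow_le_pow_left₀ (abs_nonneg _) h 2
  rw [sq_abs] at this
  nlinarith [sq_nonneg l]

end Algebra

/-! ### Regularity of `Λ` and construction of the radial profile. -/

section Phi

variable {φ : ℝ → ℝ}

namespace AdmissiblePhi

theorem differentiableAt (hφ : AdmissiblePhi φ) {s : ℝ} (hs : 0 < s) : DifferentiableAt ℝ φ s :=
  (hφ.contDiffOn.differentiableOn (by norm_num)).differentiableAt (Ioi_mem_nhds hs)

theorem continuousOn_deriv (hφ : AdmissiblePhi φ) : ContinuousOn (deriv φ) (Ioi 0) :=
  hφ.contDiffOn.continuousOn_deriv_of_isOpen isOpen_Ioi (by norm_num)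

theorem add_mul_deriv_pos (hφ : AdmissiblePhi φ) {s : ℝ} (hs : 0 < s) :
    0 < φ s + s * deriv φ s := by
  have := hφ.deriv_pos s hs
  rwa [((hasDerivAt_id' s).fun_mul (hφ.differentiableAt hs).hasDerivAt).deriv, one_mul] at this

theorem hasDerivAt_mul (hφ : AdmissiblePhi φ) {s : ℝ} (hs : 0 < s) :
    HasDerivAt (fun s => s * φ s) (φ s + s * deriv φ s) s := by
  simpa using (hasDerivAt_id' s).fun_mul (hφ.differentiableAt hs).hasDerivAt

theorem hasDerivAt_sqrt (hφ : AdmissiblePhi φ) {s : ℝ} (hs : 0 < s) :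
    HasDerivAt (fun s => √(φ s)) (deriv φ s / (2 * √(φ s))) s :=
  (hφ.differentiableAt hs).hasDerivAt.sqrt (hφ.pos s hs).ne'

theorem hasDerivAt_mul_sqrt (hφ : AdmissiblePhi φ) {s : ℝ} (hs : 0 < s) :
    HasDerivAt (fun s => s * √(φ s)) (√(φ s) + s * (deriv φ s / (2 * √(φ s)))) s := by
  simpa using (hasDerivAt_id' s).fun_mul (hφ.hasDerivAt_sqrt hs)

theorem deriv_mul_sqrt_pos (hφ : AdmissiblePhi φ) {s : ℝ} (hs : 0 < s) :
    0 < √(φ s) + s * (deriv φ s / (2 * √(φ s))) := by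
  have hp := hφ.pos s hs
  have hq : 0 < √(φ s) := Real.sqrt_pos.2 hp
  have h2 := hφ.add_mul_deriv_pos hs
  have : √(φ s) + s * (deriv φ s / (2 * √(φ s))) = (2 * φ s + s * deriv φ s) / (2 * √(φ s)) := by
    field_simp
    rw [Real.sq_sqrt hp.le]
    ring
  rw [this]
  have h3 : 0 < 2 * φ s + s * deriv φ s := by linarith
  positivity

theorem strictMonoOn_mul_sqrt (hφ : AdmissiblePhi φ) :
    StrictMonoOn (fun s => s * √(φ s)) (Ioi 0) := by
  refine strictMonoOn_of_deriv_pos (convex_Ioi 0)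
    (fun s hs => (hφ.hasDerivAt_mul_sqrt hs).continuousAt.continuousWithinAt) fun s hs => ?_
  rw [interior_Ioi] at hs
  rw [(hφ.hasDerivAt_mul_sqrt hs).deriv]
  exact hφ.deriv_mul_sqrt_pos hs

theorem lamParam_spec (hφ : AdmissiblePhi φ) {t : ℝ} (ht : 0 < t) :
    0 < lamParam φ t ∧ lamParam φ t * √(φ (lamParam φ t)) = t := by
  have := hφ.surjOn (show t ∈ Ioi (0 : ℝ) from ht)
  exact ⟨Function.invFunOn_mem this, Function.invFunOn_eq this⟩

/-- The inverse of an increasing function is monotone, and since its image is all of `(0, ∞)` it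
cannot jump. -/
theorem continuousOn_lamParam (hφ : AdmissiblePhi φ) : ContinuousOn (lamParam φ) (Ioi 0) := by
  have hmono : MonotoneOn (lamParam φ) (Ioi 0) := by
    intro a ha b hb hab
    obtain ⟨h1, h2⟩ := hφ.lamParam_spec ha
    obtain ⟨h3, h4⟩ := hφ.lamParam_spec hb
    rw [← hφ.strictMonoOn_mul_sqrt.le_iff_le h1 h3]
    simpa only [h2, h4] using hab
  have himg : Ioi 0 ⊆ lamParam φ '' Ioi 0 := by
    intro s hs
    refine ⟨s * √(φ s), mul_pos hs (Real.sqrt_pos.2 (hφ.pos s hs)), ?_⟩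
    exact hφ.injOn.leftInvOn_invFunOn (show s ∈ Ioi (0 : ℝ) from hs)
  intro t ht
  refine (continuousAt_of_monotoneOn_of_image_mem_nhds hmono (Ioi_mem_nhds ht)
    (mem_of_superset (Ioi_mem_nhds (hφ.lamParam_spec ht).1) himg)).continuousWithinAt

theorem continuousOn_Lam (hφ : AdmissiblePhi φ) : ContinuousOn (Lam φ) (Ioi 0) := by
  have h1 : MapsTo (lamParam φ) (Ioi 0) (Ioi 0) := fun t ht => (hφ.lamParam_spec ht).1
  have hd := hφ.continuousOn_deriv.comp hφ.continuousOn_lamParam h1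
  have hc := hφ.contDiffOn.continuousOn.comp hφ.continuousOn_lamParam h1
  refine ((hφ.continuousOn_lamParam.mul hd).div
    ((hφ.continuousOn_lamParam.mul hd).add (continuousOn_const.mul hc)) fun t ht => ?_).neg
  have h2 := hφ.add_mul_deriv_pos (h1 ht)
  have h3 := hφ.pos _ (h1 ht)
  have h4 : 0 < lamParam φ t * deriv φ (lamParam φ t) + 2 * φ (lamParam φ t) := by linarith
  exact h4.ne'

theorem Lam_sq_le (hφ : AdmissiblePhi φ) {t : ℝ} (ht : 0 < t) : Lam φ t ^ 2 ≤ LamInfSq φ := by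
  refine le_csSup ⟨1, ?_⟩ ⟨t, ht, rfl⟩
  rintro _ ⟨t, ht, rfl⟩
  exact (Lam_sq_lt_one hφ ht).le

/-- The common inverse substitution: there is a function `ρ` on the line, positive off the origin
and with prescribed value at `1`, such that `ρ`, `ρ φ(ρ)` and `ρ √φ(ρ)` are continuously
differentiable. -/
theorem exists_profile (hφ : AdmissiblePhi φ) {s₀ : ℝ} (hs₀ : 0 < s₀) :
    ∃ ρ : ℝ → ℝ, ρ 0 = 0 ∧ ρ 1 = s₀ ∧ (∀ τ, 0 ≤ ρ τ) ∧ ContDiff ℝ 1 ρ ∧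
      ContDiff ℝ 1 (fun τ => φ (ρ τ) * ρ τ) ∧ ContDiff ℝ 1 (fun τ => √(φ (ρ τ)) * ρ τ) := by
  -- Each of the three summands is positive with positive derivative, so each is dominated by `F`,
  -- and its derivative by `F'`. In the variable `y = F s` all three are therefore at most `y` with
  -- derivative at most `1`.
  set F : ℝ → ℝ := fun s => s + s * φ s + s * √(φ s) with hF
  set F' : ℝ → ℝ := fun s => 1 + (φ s + s * deriv φ s) +
    (√(φ s) + s * (deriv φ s / (2 * √(φ s)))) with hF'
  have hFd : ∀ s, 0 < s → HasDerivAt F (F' s) s := fun s hs =>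
    ((hasDerivAt_id' s).add (hφ.hasDerivAt_mul hs)).add (hφ.hasDerivAt_mul_sqrt hs)
  have hF'1 : ∀ s, 0 < s → 1 < F' s := fun s hs => by
    have := hφ.add_mul_deriv_pos hs
    have := hφ.deriv_mul_sqrt_pos hs
    simp only [hF']; linarith
  have hq : ∀ s, 0 < s → 0 < √(φ s) := fun s hs => Real.sqrt_pos.2 (hφ.pos s hs)
  have hFpos : ∀ s, 0 < s → s < F s := fun s hs => by
    have := mul_pos hs (hφ.pos s hs)
    have := mul_pos hs (hq s hs)
    simp only [hF]; linarith
  have hFm : StrictMonoOn F (Ioi 0) := by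
    refine strictMonoOn_of_deriv_pos (convex_Ioi 0)
      (fun s hs => (hFd s hs).continuousAt.continuousWithinAt) fun s hs => ?_
    rw [interior_Ioi] at hs
    rw [(hFd s hs).deriv]
    linarith [hF'1 s hs]
  have hsurj : ∀ y, 0 < y → ∃ s, 0 < s ∧ F s = y := by
    intro y hy
    -- Choose `s` so small that each of the three summands is at most `y / 3`.
    have hsmall : ∃ s ∈ Ioi (0 : ℝ), F s ≤ y := by
      obtain ⟨s, hs, hsy⟩ := hφ.surjOn (show y / 3 ∈ Ioi (0 : ℝ) by simpa using hy)
      obtain ⟨p, hp, hpy⟩ : y / 3 ∈ (fun s => s * φ s) '' Ioi 0 := by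
        rw [hφ.range_eq]; simpa using hy
      have hm : 0 < min (min s p) (y / 3) := lt_min (lt_min hs hp) (by positivity)
      refine ⟨_, hm, ?_⟩
      have hmulm : StrictMonoOn (fun s => s * φ s) (Ioi 0) := by
        refine strictMonoOn_of_deriv_pos (convex_Ioi 0)
          (fun s hs => (hφ.hasDerivAt_mul hs).continuousAt.continuousWithinAt) fun s hs => ?_
        rw [interior_Ioi] at hs
        exact hφ.deriv_pos s hs
      have h1 := hmulm.monotoneOn hm hp ((min_le_left _ _).trans (min_le_right _ _))
      have h2 := hφ.strictMonoOn_mul_sqrt.monotoneOn hm hs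
        ((min_le_left _ _).trans (min_le_left _ _))
      have h3 := min_le_right (min s p) (y / 3)
      simp only [hF] at *
      linarith
    obtain ⟨s, hs, hsy⟩ := hsmall
    obtain ⟨z, hz, hzy⟩ := isPreconnected_Ioi.intermediate_value hs (show y ∈ Ioi (0 : ℝ) from hy)
      (fun s hs => (hFd s hs).continuousAt.continuousWithinAt) ⟨hsy, (hFpos y hy).le⟩
    exact ⟨z, hz, hzy⟩
  choose! f hf0 hfF using hsurj
  have hfinv : ∀ s, 0 < s → f (F s) = s := fun s hs =>
    hFm.injOn (hf0 _ (hs.trans (hFpos s hs))) hs (hfF _ (hs.trans (hFpos s hs)))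
  have hfmono : MonotoneOn f (Ioi 0) := by
    intro a ha b hb hab
    rw [← hFm.le_iff_le (hf0 a ha) (hf0 b hb), hfF a ha, hfF b hb]
    exact hab
  have hfc : ∀ y, 0 < y → ContinuousAt f y := fun y hy =>
    continuousAt_of_monotoneOn_of_image_mem_nhds hfmono (Ioi_mem_nhds hy)
      (mem_of_superset (Ioi_mem_nhds (hf0 y hy))
        fun s hs => ⟨F s, lt_trans (mem_Ioi.1 hs) (hFpos s hs), hfinv s hs⟩)
  have hfd : ∀ y, 0 < y → HasDerivAt f (F' (f y))⁻¹ y := fun y hy =>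
    (hFd _ (hf0 y hy)).of_local_left_inverse (hfc y hy)
      (zero_lt_one.trans (hF'1 _ (hf0 y hy))).ne'
      (by filter_upwards [Ioi_mem_nhds hy] with z hz using hfF z hz)
  have hφc := hφ.contDiffOn.continuousOn
  have hsq : ContinuousOn (fun s => √(φ s)) (Ioi 0) := hφc.sqrt
  have hcm : ContinuousOn (fun s => φ s + s * deriv φ s) (Ioi 0) :=
    hφc.add (continuousOn_id.mul hφ.continuousOn_deriv)
  have hcs : ContinuousOn (fun s => √(φ s) + s * (deriv φ s / (2 * √(φ s)))) (Ioi 0) :=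
    hsq.add (continuousOn_id.mul (hφ.continuousOn_deriv.div (continuousOn_const.mul hsq)
      fun s hs => (mul_pos two_pos (hq s hs)).ne'))
  have hF'c : ContinuousOn F' (Ioi 0) := (continuousOn_const.add hcm).add hcs
  have hmaps : MapsTo f (Ioi 0) (Ioi 0) := fun y hy => hf0 y hy
  have hfcon : ContinuousOn f (Ioi 0) := fun y hy => (hfc y hy).continuousWithinAt
  -- This scaling gives the profile `F⁻¹(c τ²)` the value `s₀` at `τ = 1`.
  set c := F s₀ with hc
  have hc0 : 0 < c := hs₀.trans (hFpos s₀ hs₀)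
  have key : ∀ k k' : ℝ → ℝ, k 0 = 0 → (∀ s, 0 < s → HasDerivAt k (k' s) s) →
      ContinuousOn k' (Ioi 0) → (∀ s, 0 < s → |k s| ≤ F s) → (∀ s, 0 < s → |k' s| ≤ F' s) →
      ContDiff ℝ 1 fun τ => k (if τ = 0 then 0 else f (c * τ ^ 2)) := by
    intro k k' hk0 hk hk'c hkF hk'F
    have := contDiff_comp_mul_sq (K := fun y => k (if y = 0 then 0 else f y))
      (K' := fun y => k' (f y) * (F' (f y))⁻¹) hc0 (by simpa using hk0) (fun y hy => ?_)
      ((hk'c.comp hfcon hmaps).mul ((hF'c.comp hfcon hmaps).inv₀ fun y hy =>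
        (zero_lt_one.trans (hF'1 _ (hf0 y hy))).ne')) (fun y hy => ?_) (fun y hy => ?_)
    · simpa [hc0.ne'] using this
    · refine ((hk _ (hf0 y hy)).comp y (hfd y hy)).congr_of_eventuallyEq ?_
      filter_upwards [Ioi_mem_nhds hy] with z hz
      have hz' : (z : ℝ) ≠ 0 := (mem_Ioi.1 hz).ne'
      simp [hz']
    · have := hkF _ (hf0 y hy)
      rw [hfF y hy] at this
      simpa [hy.ne'] using this
    · have h1 := zero_lt_one.trans (hF'1 _ (hf0 y hy))
      rw [abs_mul, abs_inv, abs_of_pos h1, ← div_eq_mul_inv, div_le_one h1]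
      exact hk'F _ (hf0 y hy)
  refine ⟨fun τ => if τ = 0 then 0 else f (c * τ ^ 2), by simp, by simp [hc, hfinv s₀ hs₀],
    fun τ => ?_, ?_, ?_, ?_⟩
  · dsimp only
    split_ifs with h
    · exact le_rfl
    · exact (hf0 _ (by positivity)).le
  · exact key id (fun _ => 1) rfl (fun s _ => hasDerivAt_id s) continuousOn_const
      (fun s hs => by simpa [abs_of_pos hs] using (hFpos s hs).le)
      fun s hs => by simpa using (hF'1 s hs).le
  · have := key (fun s => s * φ s) _ (by simp) (fun s hs => hφ.hasDerivAt_mul hs) hcm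
      (fun s hs => ?_) (fun s hs => ?_)
    · simpa only [mul_comm] using this
    · have h1 := mul_pos hs (hφ.pos s hs)
      have h2 := mul_pos hs (hq s hs)
      rw [abs_of_pos h1]; simp only [hF]; linarith
    · have h1 := hφ.add_mul_deriv_pos hs
      have h2 := hφ.deriv_mul_sqrt_pos hs
      rw [abs_of_pos h1]; simp only [hF']; linarith
  · have := key (fun s => s * √(φ s)) _ (by simp) (fun s hs => hφ.hasDerivAt_mul_sqrt hs) hcs
      (fun s hs => ?_) (fun s hs => ?_)
    · simpa only [mul_comm] using this
    · have h1 := mul_pos hs (hφ.pos s hs)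
      have h2 := mul_pos hs (hq s hs)
      rw [abs_of_pos h2]; simp only [hF]; linarith
    · have h1 := hφ.add_mul_deriv_pos hs
      have h2 := hφ.deriv_mul_sqrt_pos hs
      rw [abs_of_pos h2]; simp only [hF']; linarith

end AdmissiblePhi

end Phi

/-! ### Calculus of `G(|u|) u` and the passage from `u` to `√φ(|u|) u`. -/

section Radial

variable {n m : ℕ} {φ : ℝ → ℝ}

/-- The derivative of `U ↦ G(|U|) U` in the direction `ζ`. -/
noncomputable def radialDeriv (G : ℝ → ℝ) (U ζ : CSpace m) : CSpace m :=
  G ‖U‖ • ζ + (deriv G ‖U‖ / ‖U‖ * reInner U ζ) • U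

theorem pd_radial {G : ℝ → ℝ} {u : RSpace n → CSpace m} {x : RSpace n}
    (hG : DifferentiableAt ℝ G ‖u x‖) (hu : DifferentiableAt ℝ u x) (hx : u x ≠ 0) (h : Fin n) :
    pd h (fun y => G ‖u y‖ • u y) x = radialDeriv G (u x) (pd h u x) := by
  have hN : DifferentiableAt ℝ (fun y => ‖u y‖) x := hu.norm ℂ hx
  set e : RSpace n := EuclideanSpace.single h 1
  have hx' : ‖u x‖ ≠ 0 := norm_ne_zero_iff.2 hx
  -- Obtained by comparing two computations of the derivative of `|u|²`.
  have hNe : fderiv ℝ (fun y => ‖u y‖) x e = reInner (u x) (fderiv ℝ u x e) / ‖u x‖ := by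
    have h1 := (hN.hasFDerivAt.pow 2).unique hu.hasFDerivAt.norm_sq
    have h2 := congrArg (fun l => l e) h1
    simp only [smul_apply, ContinuousLinearMap.comp_apply,
      innerSL_apply_apply] at h2
    rw [reInner_eq_inner_real, eq_div_iff hx']
    simp only [nsmul_eq_mul, smul_eq_mul] at h2
    norm_num at h2
    linarith
  have hd := (hG.hasDerivAt.comp_hasFDerivAt x hN.hasFDerivAt).smul hu.hasFDerivAt
  rw [pd, show (fun y => G ‖u y‖ • u y) = (G ∘ fun y => ‖u y‖) • u from rfl, hd.fderiv]
  simp only [add_apply, smul_apply,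
    ContinuousLinearMap.smulRight_apply, Function.comp_apply, radialDeriv, pd]
  congr 2
  change deriv G ‖u x‖ * fderiv ℝ (fun y => ‖u y‖) x e = _
  rw [hNe]
  ring

/-- In terms of `V`-derivatives, where `V = √φ(|U|) U`, the form `Re ⟨A ζ, ·⟩` applied to the
derivative of `φ(|U|) U` is `phiForm`. -/
theorem reInner_matAct_radialDeriv (hφ : AdmissiblePhi φ) (A : Matrix (Fin m) (Fin m) ℂ)
    {U : CSpace m} (hU : U ≠ 0) (ζ : CSpace m) :
    reInner (matAct A ζ) (radialDeriv φ U ζ) =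
      phiForm A (Lam φ (‖U‖ * √(φ ‖U‖))) (‖U‖⁻¹ • U)
        (radialDeriv (fun s => √(φ s)) U ζ) := by
  set s := ‖U‖ with hs
  have hs0 : 0 < s := norm_pos_iff.2 hU
  have hp := hφ.pos s hs0
  set q := √(φ s) with hq
  have hq0 : 0 < q := Real.sqrt_pos.2 hp
  have hqq : φ s = q ^ 2 := (Real.sq_sqrt hp.le).symm
  have hd := hφ.add_mul_deriv_pos hs0
  have hd2 : s * deriv φ s + 2 * q ^ 2 ≠ 0 := by rw [← hqq]; linarith
  set ξ := radialDeriv (fun s => √(φ s)) U ζ with hξ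
  have hξ' : ξ = q • ζ + (deriv φ s / (2 * q) / s * reInner U ζ) • U := by
    rw [hξ, radialDeriv, (hφ.hasDerivAt_sqrt hs0).deriv]
  have hUU : reInner U U = s ^ 2 := reInner_self U
  -- `Λ` is exactly the factor that makes `ξ + Λ r ω` a multiple of `ζ`, where `ω = U/|U|` and `r =
  -- Re ⟨ω, ξ⟩`; then `ξ - Λ r ω` is a multiple of the derivative of `φ(|U|) U`.
  have hr : Lam φ (s * q) * reInner (s⁻¹ • U) ξ * s⁻¹ =
      -(deriv φ s / (2 * q) / s * reInner U ζ) := by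
    rw [Lam_spec hφ hs0, hξ', reInner_smul_left, reInner_add_right, reInner_smul_right,
      reInner_smul_right, hUU, hqq]
    field_simp
    ring
  have h1 : ξ + (Lam φ (s * q) * reInner (s⁻¹ • U) ξ) • s⁻¹ • U = q • ζ := by
    rw [smul_smul, hr, hξ']; module
  have h2 : ξ - (Lam φ (s * q) * reInner (s⁻¹ • U) ξ) • s⁻¹ • U =
      q⁻¹ • radialDeriv φ U ζ := by
    rw [smul_smul, hr, hξ', radialDeriv, ← hs, hqq, smul_add, smul_smul, smul_smul, neg_smul,
      sub_neg_eq_add, add_assoc, ← add_smul]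
    congr 2
    · field_simp
    · field_simp
      ring
  rw [phiForm, h1, h2, matAct_smul, reInner_smul_left, reInner_smul_right]
  field_simp

/-- Every direction and every derivative of `√φ(|U|) U` is attained. -/
theorem exists_radialDeriv_eq (hφ : AdmissiblePhi φ) {ω : CSpace m} (hω : ‖ω‖ = 1) {t : ℝ}
    (ht : 0 < t) (ξ : CSpace m) :
    ∃ U ζ : CSpace m, U ≠ 0 ∧ ‖U‖ * √(φ ‖U‖) = t ∧ ‖U‖⁻¹ • U = ω ∧
      radialDeriv (fun s => √(φ s)) U ζ = ξ := by
  obtain ⟨s, hs, hst⟩ := hφ.surjOn (show t ∈ Ioi (0 : ℝ) from ht)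
  have hs0 : 0 < s := hs
  have hn : ‖s • ω‖ = s := by rw [norm_smul, hω, Real.norm_of_nonneg hs0.le, mul_one]
  have hp := hφ.pos s hs0
  set q := √(φ s) with hq
  have hq0 : 0 < q := Real.sqrt_pos.2 hp
  have hqq : φ s = q ^ 2 := (Real.sq_sqrt hp.le).symm
  have hd := hφ.add_mul_deriv_pos hs0
  have hd2 : s * deriv φ s + 2 * q ^ 2 ≠ 0 := by rw [← hqq]; linarith
  have hωω : reInner ω ω = 1 := by rw [reInner_self, hω, one_pow]
  -- The derivative of `√φ(|U|) U` is `q` times the identity plus a multiple of the projection onto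
  -- `ω`; this `ζ` is its explicit inverse applied to `ξ`.
  refine ⟨s • ω, q⁻¹ • (ξ - (s * deriv φ s / (s * deriv φ s + 2 * q ^ 2) * reInner ω ξ) • ω),
    ?_, by rw [hn]; exact hst, ?_, ?_⟩
  · rw [← norm_pos_iff, hn]; exact hs0
  · rw [hn, smul_smul, inv_mul_cancel₀ hs0.ne', one_smul]
  · rw [radialDeriv, hn, (hφ.hasDerivAt_sqrt hs0).deriv]
    simp only [← hq, reInner_smul_left, reInner_smul_right, reInner_sub_right, hωω]
    rw [smul_smul, mul_inv_cancel₀ hq0.ne', one_smul, smul_smul, sub_add, ← sub_smul,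
      show s * deriv φ s / (s * deriv φ s + 2 * q ^ 2) * reInner ω ξ - _ = 0 from ?_, zero_smul,
      sub_zero]
    field_simp
    ring

theorem norm_sqrtPhiMul {u : RSpace n → CSpace m} (x : RSpace n) :
    ‖sqrtPhiMul φ u x‖ = ‖u x‖ * √(φ ‖u x‖) := by
  rw [sqrtPhiMul, norm_smul, Real.norm_of_nonneg (Real.sqrt_nonneg _), mul_comm]

theorem normalize_sqrtPhiMul (hφ : AdmissiblePhi φ) {u : RSpace n → CSpace m} {x : RSpace n}
    (hx : u x ≠ 0) :
    ‖sqrtPhiMul φ u x‖⁻¹ • sqrtPhiMul φ u x = ‖u x‖⁻¹ • u x := by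
  have hq := (Real.sqrt_pos.2 (hφ.pos _ (norm_pos_iff.2 hx))).ne'
  rw [norm_sqrtPhiMul, sqrtPhiMul, smul_smul]
  congr 1
  field_simp

theorem pd_phiMul (hφ : AdmissiblePhi φ) {u : RSpace n → CSpace m} {x : RSpace n}
    (hu : DifferentiableAt ℝ u x) (hx : u x ≠ 0) (h : Fin n) :
    pd h (phiMul φ u) x = radialDeriv φ (u x) (pd h u x) :=
  pd_radial (hφ.differentiableAt (norm_pos_iff.2 hx)) hu hx h

theorem pd_sqrtPhiMul (hφ : AdmissiblePhi φ) {u : RSpace n → CSpace m} {x : RSpace n}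
    (hu : DifferentiableAt ℝ u x) (hx : u x ≠ 0) (h : Fin n) :
    pd h (sqrtPhiMul φ u) x = radialDeriv (fun s => √(φ s)) (u x) (pd h u x) :=
  pd_radial (hφ.hasDerivAt_sqrt (norm_pos_iff.2 hx)).differentiableAt hu hx h

/-- The energy density in terms of `√φ(|u|) u`, off the zero set. -/
theorem reInner_matAct_pd (hφ : AdmissiblePhi φ) (A : Matrix (Fin m) (Fin m) ℂ)
    {u : RSpace n → CSpace m} {x : RSpace n} (hu : DifferentiableAt ℝ u x) (hx : u x ≠ 0)
    (h : Fin n) :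
    reInner (matAct A (pd h u x)) (pd h (phiMul φ u) x) =
      phiForm A (Lam φ ‖sqrtPhiMul φ u x‖) (‖sqrtPhiMul φ u x‖⁻¹ • sqrtPhiMul φ u x)
        (pd h (sqrtPhiMul φ u) x) := by
  rw [pd_phiMul hφ hu hx, pd_sqrtPhiMul hφ hu hx, normalize_sqrtPhiMul hφ hx, norm_sqrtPhiMul,
    reInner_matAct_radialDeriv hφ A hx]

theorem pd_eq_zero {u : RSpace n → CSpace m} {x : RSpace n} (hx : fderiv ℝ u x = 0) (h : Fin n) :
    pd h u x = 0 := by simp [pd, hx]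

/-- At a zero of `u` with vanishing derivative, `√φ(|u|) u` has vanishing derivative too. -/
theorem fderiv_sqrtPhiMul_eq_zero (hφ : AdmissiblePhi φ) {u : RSpace n → CSpace m} {x : RSpace n}
    (hu : DifferentiableAt ℝ u x) (hw : DifferentiableAt ℝ (phiMul φ u) x) (hx : u x = 0)
    (hx' : fderiv ℝ u x = 0) : fderiv ℝ (sqrtPhiMul φ u) x = 0 := by
  have hv0 : sqrtPhiMul φ u x = 0 := by simp [sqrtPhiMul, hx]
  have hw0 : phiMul φ u x = 0 := by simp [phiMul, hx]
  have h1 : (fun y => ‖u y‖) =o[𝓝 x] fun y => ‖y - x‖ := by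
    have := hu.hasFDerivAt.isLittleO
    simpa [hx, hx'] using this.norm_norm
  have h2 : (fun y => ‖phiMul φ u y‖) =O[𝓝 x] fun y => ‖y - x‖ := by
    have := hw.hasFDerivAt.isBigO_sub
    simpa [hw0] using this.norm_norm
  -- Since `|√φ(|u|) u|² = |u| · |φ(|u|) u|`, the factors `o(|y - x|)` and `O(|y - x|)` give `o(|y -
  -- x|²)`, with no growth condition on `φ`.
  have h3 := h1.mul_isBigO h2
  have h4 : (fun y => ‖sqrtPhiMul φ u y‖ ^ 2) =o[𝓝 x] fun y => ‖y - x‖ ^ 2 := by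
    refine (h3.congr (fun y => ?_) fun y => (sq _).symm)
    rcases eq_or_ne (u y) 0 with hy | hy
    · simp [sqrtPhiMul, hy]
    · have hp := hφ.pos _ (norm_pos_iff.2 hy)
      rw [norm_sqrtPhiMul, phiMul, norm_smul, Real.norm_of_nonneg hp.le, mul_pow,
        Real.sq_sqrt hp.le]
      ring
  have h5 : (fun y => sqrtPhiMul φ u y) =o[𝓝 x] fun y => y - x := by
    rw [← Asymptotics.isLittleO_norm_norm]
    exact Asymptotics.IsLittleO.of_pow (n := 2) h4 (by norm_num)
  refine HasFDerivAt.fderiv (HasFDerivAt.of_isLittleO ?_)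
  simpa [hv0] using h5

end Radial

/-! ### Diagonal coefficients: all conditions in terms of `phiForm`. -/

section Diagonal

variable {n m : ℕ} {φ : ℝ → ℝ} {Ω : Set (RSpace n)}
  {a : Fin n → RSpace n → Matrix (Fin m) (Fin m) ℂ}

theorem energy_diagTensor (u w : RSpace n → CSpace m) :
    energy Ω (diagTensor a) u w =
      ∫ x in Ω, ∑ h, reInner (matAct (a h x) (pd h u x)) (pd h w x) := by
  unfold energy
  congr 1
  ext x
  refine Finset.sum_congr rfl fun h _ => ?_
  rw [Finset.sum_eq_single h]
  · simp [diagTensor]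
  · intro k _ hk
    simp [diagTensor, hk.symm]
  · simp

theorem subLaplacian_diagTensor (κ : ℝ) :
    subLaplacian (diagTensor a) κ = diagTensor fun h x => a h x - (κ : ℂ) • 1 := by
  ext h k x : 3
  by_cases hk : h = k <;> simp [subLaplacian, diagTensor, hk]

theorem phiIntegrand_diagTensor (v : RSpace n → CSpace m) {x : RSpace n} (hx : v x ≠ 0) :
    phiIntegrand φ (diagTensor a) v x =
      ∑ h, phiForm (a h x) (Lam φ ‖v x‖) (‖v x‖⁻¹ • v x) (pd h v x) := by
  rw [phiIntegrand, indicator_of_mem (show x ∈ {y | v y ≠ 0} from hx)]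
  refine Finset.sum_congr rfl fun h _ => ?_
  rw [Finset.sum_eq_single h]
  · have : ‖v x‖ ≠ 0 := norm_ne_zero_iff.2 hx
    rw [← phiForm_expand_conjTranspose]
    simp only [diagTensor, if_true, matAct_smul, reInner_smul_left, reInner_smul_right]
    field_simp
  · intro k _ hk
    simp [diagTensor, hk, hk.symm]
  · simp

theorem phiIntegrand_eq_zero (T : CoeffTensor n m) {v : RSpace n → CSpace m} {x : RSpace n}
    (hx : v x = 0) : phiIntegrand φ T v x = 0 :=
  indicator_of_notMem (by simpa using hx) _

/-- Pointwise ellipticity of the diagonal coefficients. -/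
def DiagPhiElliptic (φ : ℝ → ℝ) (Ω : Set (RSpace n))
    (a : Fin n → RSpace n → Matrix (Fin m) (Fin m) ℂ) : Prop :=
  ∃ κ : ℝ, 0 < κ ∧ ∀ᵐ x ∂(volume.restrict Ω), ∀ (h : Fin n) (ξ ω : CSpace m) (t : ℝ),
    ‖ω‖ = 1 → 0 < t → κ * ‖ξ‖ ^ 2 ≤ phiForm (a h x) (Lam φ t) ω ξ

theorem symbolMatrix_diagTensor (x q : RSpace n) :
    symbolMatrix (diagTensor a) x q = ∑ h, ((q h ^ 2 : ℝ) : ℂ) • a h x := by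
  refine Finset.sum_congr rfl fun h _ => ?_
  rw [Finset.sum_eq_single h]
  · simp [diagTensor, sq]
  · intro k _ hk
    simp [diagTensor, hk.symm]
  · simp

theorem weak_form_diagTensor (x q : RSpace n) (ξ ω : CSpace m) (l : ℝ) :
    reInner (matAct (symbolMatrix (diagTensor a) x q) ξ) ξ
      - l ^ 2 * reInner (matAct (symbolMatrix (diagTensor a) x q) ω) ω * reInner ξ ω ^ 2
      + l * (reInner (matAct (symbolMatrix (diagTensor a) x q) ω) ξ
        - reInner (matAct (symbolMatrix (diagTensor a) x q) ξ) ω) * reInner ξ ω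
      = ∑ h, q h ^ 2 * phiForm (a h x) l ω ξ := by
  have hexp : ∀ y z : CSpace m, reInner (matAct (symbolMatrix (diagTensor a) x q) y) z =
      ∑ h, q h ^ 2 * reInner (matAct (a h x) y) z := by
    intro y z
    rw [symbolMatrix_diagTensor, matAct_sum_matrix, reInner_eq_inner_real, sum_inner]
    refine Finset.sum_congr rfl fun h _ => ?_
    rw [matAct_real_smul_matrix, ← reInner_eq_inner_real, reInner_smul_left]
  simp only [hexp, phiForm_expand, ← Finset.sum_sub_distrib, Finset.mul_sum, Finset.sum_mul,
    ← Finset.sum_add_distrib, reInner_comm ξ ω]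
  refine Finset.sum_congr rfl fun h _ => ?_
  ring

/-- Coordinate vectors `q` isolate the individual matrices; conversely the inequalities are summed
with the weights `q_h²`. The constant is the same. -/
theorem weakPhiElliptic_iff :
    WeakPhiElliptic φ Ω (diagTensor a) ↔ DiagPhiElliptic φ Ω a := by
  simp only [WeakPhiElliptic, weak_form_diagTensor]
  refine exists_congr fun κ => and_congr_right fun _ => eventually_congr ?_
  refine Eventually.of_forall fun x => ⟨fun hx h ξ ω t hω ht => ?_, fun hx q ξ ω t hω ht => ?_⟩
  · have := hx (EuclideanSpace.single h 1) ξ ω t hω ht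
    rw [Finset.sum_eq_single h] at this
    · simpa using this
    · intro k _ hk
      simp [hk]
    · simp
  · rw [EuclideanSpace.norm_sq_eq, Finset.mul_sum, Finset.sum_mul]
    refine Finset.sum_le_sum fun h _ => ?_
    have := mul_le_mul_of_nonneg_left (hx h ξ ω t hω ht) (sq_nonneg (q h))
    rw [Real.norm_eq_abs, sq_abs]
    linarith

/-- Take `ξ` with a single nonzero component. -/
theorem StrongPhiElliptic.diagPhiElliptic (hs : StrongPhiElliptic φ Ω (diagTensor a)) :
    DiagPhiElliptic φ Ω a := by
  obtain ⟨κ, hκ, hx⟩ := hs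
  refine ⟨κ, hκ, hx.mono fun x hx h ξ ω t hω ht => ?_⟩
  have := hx (Pi.single h ξ) ω t hω ht
  rw [Finset.sum_eq_single h (by intro k _ hk; simp [hk]) (by simp),
    Finset.sum_eq_single h (by intro k _ hk; simp [hk]) (by simp),
    Finset.sum_eq_single h (by intro k _ hk; simp [hk, diagTensor, hk.symm]) (by simp)] at this
  simp only [Pi.single_eq_same, diagTensor, if_true] at this
  rwa [phiForm_expand_conjTranspose] at this

end Diagonal

/-! ### Integrability of the energy densities. -/

section Integrability

variable {n m : ℕ} {φ : ℝ → ℝ} {Ω : Set (RSpace n)}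
  {a : Fin n → RSpace n → Matrix (Fin m) (Fin m) ℂ}

/-- Locally integrable coefficients paired with bounded measurable fields of compact support. -/
theorem integrable_reInner_matAct {A : RSpace n → Matrix (Fin m) (Fin m) ℂ}
    (hA : ∀ i j, LocallyIntegrableOn (fun x => A x i j) Ω volume) {K : Set (RSpace n)}
    (hK : IsCompact K) (hKΩ : K ⊆ Ω) {X Y : RSpace n → CSpace m} (hX : Measurable X)
    (hY : Measurable Y) {C : ℝ} (hXC : ∀ x, ‖X x‖ ≤ C) (hYC : ∀ x, ‖Y x‖ ≤ C)
    (hXK : ∀ x, x ∉ K → X x = 0) :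
    Integrable (fun x => reInner (matAct (A x) (X x)) (Y x)) (volume.restrict Ω) := by
  have heq : (fun x => reInner (matAct (A x) (X x)) (Y x)) =
      K.indicator fun x => reInner (matAct (A x) (X x)) (Y x) := by
    ext x
    by_cases hx : x ∈ K
    · rw [indicator_of_mem hx]
    · rw [indicator_of_notMem hx, hXK x hx, matAct_zero, reInner_zero_left]
  rw [heq]
  refine Integrable.mono_measure ?_ (Measure.restrict_le_self (s := Ω))
  rw [integrable_indicator_iff hK.measurableSet]
  have hXi : ∀ i, Measurable fun x => X x i := fun i =>
    (PiLp.continuous_apply 2 _ i).measurable.comp hX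
  have hYi : ∀ i, Measurable fun x => Y x i := fun i =>
    (PiLp.continuous_apply 2 _ i).measurable.comp hY
  simp only [reInner_matAct_eq_sum, IntegrableOn]
  refine integrable_finsetSum _ fun i _ => integrable_finsetSum _ fun j _ => ?_
  refine Integrable.re (f := fun x => A x i j * X x j * (starRingEnd ℂ) (Y x i)) ?_
  have h1 : IntegrableOn (fun x => A x i j) K volume :=
    (hA i j).integrableOn_compact_subset hKΩ hK
  have h2 := (h1.mul_bdd (c := C) (f := fun x => A x i j) (g := fun x => X x j)
    (hXi j).aestronglyMeasurable
    (Eventually.of_forall fun x => (PiLp.norm_apply_le _ _).trans (hXC x)))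
  refine h2.mul_bdd (c := C) (Complex.continuous_conj.measurable.comp
    (hYi i)).aestronglyMeasurable (Eventually.of_forall fun x => ?_)
  simpa using (PiLp.norm_apply_le (Y x) i).trans (hYC x)

theorem IsTest.continuous_pd {u : RSpace n → CSpace m} (hu : IsTest Ω u) (h : Fin n) :
    Continuous (pd h u) :=
  (hu.1.continuous_fderiv (by norm_num)).clm_apply continuous_const

theorem IsTest.pd_eq_zero_of_notMem {u : RSpace n → CSpace m} (h : Fin n) {x : RSpace n}
    (hx : x ∉ tsupport u) : pd h u x = 0 :=
  pd_eq_zero (by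
    by_contra hne
    exact hx (support_fderiv_subset ℝ (Function.mem_support.2 hne))) h

theorem IsTest.exists_bound_pd {u : RSpace n → CSpace m} (hu : IsTest Ω u) (h : Fin n) :
    ∃ C, 0 ≤ C ∧ ∀ x, ‖pd h u x‖ ≤ C := by
  have hc : HasCompactSupport (pd h u) :=
    HasCompactSupport.intro hu.2.1 fun x hx => IsTest.pd_eq_zero_of_notMem h hx
  obtain ⟨C, hC⟩ := (hu.continuous_pd h).bounded_above_of_compact_support hc
  exact ⟨C, (norm_nonneg _).trans (hC 0), hC⟩

theorem IsTest.differentiableAt {u : RSpace n → CSpace m} (hu : IsTest Ω u) (x : RSpace n) :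
    DifferentiableAt ℝ u x := hu.1.differentiable (by norm_num) x

theorem IsTest.integrable_reInner_matAct_pd
    (ha : ∀ h i j, LocallyIntegrableOn (fun x => a h x i j) Ω volume)
    {u w : RSpace n → CSpace m} (hu : IsTest Ω u) (hw : IsTest Ω w) :
    Integrable (fun x => ∑ h, reInner (matAct (a h x) (pd h u x)) (pd h w x))
      (volume.restrict Ω) := by
  refine integrable_finsetSum _ fun h _ => ?_
  obtain ⟨C, hC0, hC⟩ := hu.exists_bound_pd h
  obtain ⟨D, hD0, hD⟩ := hw.exists_bound_pd h
  exact integrable_reInner_matAct (ha h) hu.2.1 hu.2.2 (hu.continuous_pd h).measurable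
    (hw.continuous_pd h).measurable (fun x => (hC x).trans (le_max_left _ _))
    (fun x => (hD x).trans (le_max_right _ _)) fun x hx => IsTest.pd_eq_zero_of_notMem h hx

theorem locallyIntegrableOn_sub_smul_one
    (ha : ∀ h i j, LocallyIntegrableOn (fun x => a h x i j) Ω volume) (κ : ℝ) :
    ∀ h i j, LocallyIntegrableOn
      (fun x => (a h x - (κ : ℂ) • (1 : Matrix (Fin m) (Fin m) ℂ)) i j) Ω volume := by
  intro h i j
  exact (ha h i j).sub (locallyIntegrableOn_const _)

theorem IsTest.integrable_gradSq {v : RSpace n → CSpace m} (hv : IsTest Ω v) :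
    Integrable (gradSq v) (volume.restrict Ω) := by
  have := hv.integrable_reInner_matAct_pd (a := fun _ _ => 1)
    (fun h i j => locallyIntegrableOn_const _) hv
  simp only [matAct_one, reInner_self] at this
  exact this

/-- The integrand is almost everywhere `∑ Re ⟨𝒜^h(∂_h v + R_h), ∂_h v - R_h⟩` with `R_h = Λ r ω`.
Because `|Λ| < 1`, these fields are bounded despite the negative powers of `|v|`, and continuity of
`Λ` makes them measurable. -/
theorem IsTest.integrable_phiIntegrand (hφ : AdmissiblePhi φ)
    (ha : ∀ h i j, LocallyIntegrableOn (fun x => a h x i j) Ω volume)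
    {v : RSpace n → CSpace m} (hv : IsTest Ω v) :
    Integrable (phiIntegrand φ (diagTensor a) v) (volume.restrict Ω) := by
  set S : Set (RSpace n) := {x | v x ≠ 0} with hS
  have hSo : IsOpen S := isOpen_ne_fun hv.1.continuous continuous_const
  set R : Fin n → RSpace n → CSpace m := fun h => S.indicator fun x =>
    (Lam φ ‖v x‖ * reInner (‖v x‖⁻¹ • v x) (pd h v x)) • ‖v x‖⁻¹ • v x with hR
  have hRm : ∀ h, Measurable (R h) := by
    intro h
    have hn : ContinuousOn (fun x => ‖v x‖) S := hv.1.continuous.norm.continuousOn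
    have hω : ContinuousOn (fun x => ‖v x‖⁻¹ • v x) S :=
      ContinuousOn.smul (hn.inv₀ fun x hx => norm_ne_zero_iff.2 hx)
        hv.1.continuous.continuousOn
    have hL : ContinuousOn (fun x => Lam φ ‖v x‖) S :=
      hφ.continuousOn_Lam.comp hn fun x hx => norm_pos_iff.2 hx
    have hr : ContinuousOn (fun x => reInner (‖v x‖⁻¹ • v x) (pd h v x)) S := by
      simp only [reInner_eq_inner_real]
      exact ContinuousOn.inner (𝕜 := ℝ) hω (hv.continuous_pd h).continuousOn
    classical
    have hm := ((hL.mul hr).smul hω).measurable_piecewise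
      (continuousOn_const (c := (0 : CSpace m))) hSo.measurableSet
    simp only [hR]
    rw [← piecewise_eq_indicator]
    exact hm
  have hRb : ∀ h x, ‖R h x‖ ≤ ‖pd h v x‖ := by
    intro h x
    by_cases hx : x ∈ S
    · have hω : ‖‖v x‖⁻¹ • v x‖ = 1 := norm_smul_inv_norm (𝕜 := ℝ) hx
      have h1 := abs_reInner_le (‖v x‖⁻¹ • v x) (pd h v x)
      have h2 : |Lam φ ‖v x‖| ≤ 1 :=
        (sq_le_one_iff_abs_le_one _).1 (Lam_sq_lt_one hφ (norm_pos_iff.2 hx)).le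
      rw [hω, one_mul] at h1
      simp only [hR]
      rw [indicator_of_mem hx, norm_smul, hω, mul_one, Real.norm_eq_abs, abs_mul]
      exact (mul_le_of_le_one_left (abs_nonneg _) h2).trans h1
    · simp only [hR]
      rw [indicator_of_notMem hx, norm_zero]
      exact norm_nonneg _
  have hae : (fun x => ∑ h, reInner (matAct (a h x) (pd h v x + R h x)) (pd h v x - R h x))
      =ᵐ[volume.restrict Ω] phiIntegrand φ (diagTensor a) v := by
    filter_upwards [ae_restrict_of_ae (ae_fderiv_eq_zero_of_eq_zero volume hv.1)] with x hx
    by_cases h0 : v x = 0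
    · rw [phiIntegrand_eq_zero _ h0]
      refine Finset.sum_eq_zero fun h _ => ?_
      simp only [hR]
      rw [indicator_of_notMem (by simpa [hS] using h0), pd_eq_zero (hx h0)]
      simp
    · rw [phiIntegrand_diagTensor v h0]
      refine Finset.sum_congr rfl fun h _ => ?_
      simp only [hR]
      rw [indicator_of_mem (show x ∈ S from h0), phiForm]
  refine Integrable.congr (integrable_finsetSum _ fun h _ => ?_) hae
  obtain ⟨C, hC0, hC⟩ := hv.exists_bound_pd h
  refine integrable_reInner_matAct (C := C + C) (ha h) hv.2.1 hv.2.2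
    ((hv.continuous_pd h).measurable.add (hRm h)) ((hv.continuous_pd h).measurable.sub (hRm h))
    (fun x => ?_) (fun x => ?_) fun x hx => ?_
  · exact (norm_add_le _ _).trans (add_le_add (hC x) ((hRb h x).trans (hC x)))
  · exact (norm_sub_le _ _).trans (add_le_add (hC x) ((hRb h x).trans (hC x)))
  · have h1 := IsTest.pd_eq_zero_of_notMem h hx
    have h2 := hRb h x
    rw [h1, norm_zero, norm_le_zero_iff] at h2
    rw [h1, h2, add_zero]

end Integrability

/-! ### Pointwise ellipticity implies the integral conditions, and these imply regular
dissipativity. -/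

section Sufficiency

variable {n m : ℕ} {φ : ℝ → ℝ} {Ω : Set (RSpace n)}
  {a : Fin n → RSpace n → Matrix (Fin m) (Fin m) ℂ}

theorem DiagPhiElliptic.integralPhiElliptic (hφ : AdmissiblePhi φ)
    (ha : ∀ h i j, LocallyIntegrableOn (fun x => a h x i j) Ω volume)
    (he : DiagPhiElliptic φ Ω a) : IntegralPhiElliptic φ Ω (diagTensor a) := by
  obtain ⟨κ, hκ, hae⟩ := he
  refine ⟨κ, hκ, fun v hv => ?_⟩
  rw [← integral_const_mul]
  refine integral_mono_ae (hv.integrable_gradSq.const_mul κ)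
    (hv.integrable_phiIntegrand hφ ha) ?_
  filter_upwards [hae, ae_restrict_of_ae (ae_fderiv_eq_zero_of_eq_zero volume hv.1)] with x h1 h2
  by_cases h0 : v x = 0
  · rw [phiIntegrand_eq_zero _ h0]
    simp [gradSq, pd_eq_zero (h2 h0)]
  · rw [phiIntegrand_diagTensor v h0, gradSq, Finset.mul_sum]
    exact Finset.sum_le_sum fun h _ =>
      h1 h _ _ _ (norm_smul_inv_norm (𝕜 := ℝ) h0) (norm_pos_iff.2 h0)

theorem norm_normalize_sqrtPhiMul (hφ : AdmissiblePhi φ) {u : RSpace n → CSpace m}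
    {x : RSpace n} (hx : u x ≠ 0) :
    ‖‖sqrtPhiMul φ u x‖⁻¹ • sqrtPhiMul φ u x‖ = 1 := by
  rw [normalize_sqrtPhiMul hφ hx]; exact norm_smul_inv_norm (𝕜 := ℝ) hx

theorem norm_sqrtPhiMul_pos (hφ : AdmissiblePhi φ) {u : RSpace n → CSpace m}
    {x : RSpace n} (hx : u x ≠ 0) : 0 < ‖sqrtPhiMul φ u x‖ := by
  have h0 := norm_pos_iff.2 hx
  rw [norm_sqrtPhiMul]
  exact mul_pos h0 (Real.sqrt_pos.2 (hφ.pos _ h0))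

theorem DiagPhiElliptic.strictPhiDissipative (hφ : AdmissiblePhi φ)
    (ha : ∀ h i j, LocallyIntegrableOn (fun x => a h x i j) Ω volume)
    (he : DiagPhiElliptic φ Ω a) : StrictPhiDissipative φ Ω (diagTensor a) := by
  obtain ⟨κ, hκ, hae⟩ := he
  refine ⟨κ, hκ, fun u hu hw => ?_⟩
  rw [energy_diagTensor, ← integral_const_mul]
  -- Here `√φ(|u|) u` is not known to be `C¹`, so nonnegativity of the smaller integrand replaces
  -- its integrability.
  refine integral_mono_of_nonneg (Eventually.of_forall fun x => ?_)
    (hu.integrable_reInner_matAct_pd ha hw) ?_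
  · exact mul_nonneg hκ.le (Finset.sum_nonneg fun h _ => sq_nonneg _)
  filter_upwards [hae, ae_restrict_of_ae (ae_fderiv_eq_zero_of_eq_zero volume hu.1)] with x h1 h2
  by_cases h0 : u x = 0
  · have h3 := fderiv_sqrtPhiMul_eq_zero hφ (hu.differentiableAt x) (hw.differentiableAt x) h0
      (h2 h0)
    simp [gradSq, pd_eq_zero h3, pd_eq_zero (h2 h0)]
  · rw [gradSq, Finset.mul_sum]
    refine Finset.sum_le_sum fun h _ => ?_
    rw [reInner_matAct_pd hφ _ (hu.differentiableAt x) h0]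
    exact h1 h _ _ _ (norm_normalize_sqrtPhiMul hφ h0) (norm_sqrtPhiMul_pos hφ h0)

theorem DiagPhiElliptic.phiDissipative_subLaplacian (hφ : AdmissiblePhi φ)
    (he : DiagPhiElliptic φ Ω a) :
    ∃ κ : ℝ, 0 < κ ∧ PhiDissipative φ Ω (subLaplacian (diagTensor a) κ) := by
  obtain ⟨κ, hκ, hae⟩ := he
  refine ⟨κ, hκ, fun u hu hw => ?_⟩
  rw [subLaplacian_diagTensor, energy_diagTensor]
  refine integral_nonneg_of_ae ?_
  filter_upwards [hae, ae_restrict_of_ae (ae_fderiv_eq_zero_of_eq_zero volume hu.1)] with x h1 h2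
  refine Finset.sum_nonneg fun h _ => ?_
  by_cases h0 : u x = 0
  · simp [pd_eq_zero (h2 h0)]
  · have hω := norm_normalize_sqrtPhiMul hφ h0
    rw [reInner_matAct_pd hφ _ (hu.differentiableAt x) h0, phiForm_sub_smul_one _ _ _ hω]
    have h3 := h1 h (pd h (sqrtPhiMul φ u) x) _ _ hω (norm_sqrtPhiMul_pos hφ h0)
    -- Subtracting `κΔ` costs at most `κ |∂_h v|²`, since the `Λ²` term has the favourable sign.
    have h4 := mul_nonneg hκ.le
      (sq_nonneg (Lam φ ‖sqrtPhiMul φ u x‖ *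
        reInner (‖sqrtPhiMul φ u x‖⁻¹ • sqrtPhiMul φ u x) (pd h (sqrtPhiMul φ u) x)))
    linarith [h4]

/-- Dissipativity of `A - κ Δ`, tested only with functions for which `√φ(|u|) u` is of class `C¹`
as well. -/
def RegularPhiDissipative (φ : ℝ → ℝ) (Ω : Set (RSpace n)) (T : CoeffTensor n m) : Prop :=
  ∀ u : RSpace n → CSpace m, IsTest Ω u → IsTest Ω (phiMul φ u) → IsTest Ω (sqrtPhiMul φ u) →
    0 ≤ energy Ω T u (phiMul φ u)

/-- The form of `A - κΔ` exceeds that of `A` minus `κ |∇v|²` by the nonnegative terms `κ Λ² r²`.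
Requiring `v = √φ(|u|) u` to be a test function lets the same reduction serve both strict
dissipativity and the integral condition. -/
theorem regularPhiDissipative_of_gradSq_le (hφ : AdmissiblePhi φ)
    (ha : ∀ h i j, LocallyIntegrableOn (fun x => a h x i j) Ω volume) {κ : ℝ} (hκ : 0 < κ)
    (he : ∀ u : RSpace n → CSpace m, IsTest Ω u → IsTest Ω (phiMul φ u) →
      IsTest Ω (sqrtPhiMul φ u) →
      κ * (∫ x in Ω, gradSq (sqrtPhiMul φ u) x) ≤ energy Ω (diagTensor a) u (phiMul φ u)) :
    RegularPhiDissipative φ Ω (subLaplacian (diagTensor a) κ) := by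
  intro u hu hw hv
  refine (sub_nonneg.2 (he u hu hw hv)).trans ?_
  rw [subLaplacian_diagTensor, energy_diagTensor, energy_diagTensor, ← integral_const_mul,
    ← integral_sub (hu.integrable_reInner_matAct_pd ha hw) (hv.integrable_gradSq.const_mul κ)]
  refine integral_mono_ae
    ((hu.integrable_reInner_matAct_pd ha hw).sub (hv.integrable_gradSq.const_mul κ))
    (hu.integrable_reInner_matAct_pd (locallyIntegrableOn_sub_smul_one ha κ) hw) ?_
  filter_upwards [ae_restrict_of_ae (ae_fderiv_eq_zero_of_eq_zero volume hu.1)] with x h2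
  rw [gradSq, Finset.mul_sum, ← Finset.sum_sub_distrib]
  refine Finset.sum_le_sum fun h _ => ?_
  by_cases h0 : u x = 0
  · have h3 := fderiv_sqrtPhiMul_eq_zero hφ (hu.differentiableAt x) (hw.differentiableAt x) h0
      (h2 h0)
    simp [pd_eq_zero h3, pd_eq_zero (h2 h0)]
  · have hω := norm_normalize_sqrtPhiMul hφ h0
    rw [reInner_matAct_pd hφ _ (hu.differentiableAt x) h0,
      reInner_matAct_pd hφ _ (hu.differentiableAt x) h0, phiForm_sub_smul_one _ _ _ hω]
    have h4 := mul_nonneg hκ.le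
      (sq_nonneg (Lam φ ‖sqrtPhiMul φ u x‖ *
        reInner (‖sqrtPhiMul φ u x‖⁻¹ • sqrtPhiMul φ u x) (pd h (sqrtPhiMul φ u) x)))
    linarith [h4]

theorem energy_eq_integral_phiIntegrand (hφ : AdmissiblePhi φ) {u : RSpace n → CSpace m}
    (hu : IsTest Ω u) :
    energy Ω (diagTensor a) u (phiMul φ u) =
      ∫ x in Ω, phiIntegrand φ (diagTensor a) (sqrtPhiMul φ u) x := by
  rw [energy_diagTensor]
  refine integral_congr_ae ?_
  filter_upwards [ae_restrict_of_ae (ae_fderiv_eq_zero_of_eq_zero volume hu.1)] with x h2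
  by_cases h0 : u x = 0
  · rw [phiIntegrand_eq_zero _ (by simp [sqrtPhiMul, h0])]
    simp [pd_eq_zero (h2 h0)]
  · rw [phiIntegrand_diagTensor _ (norm_pos_iff.1 (norm_sqrtPhiMul_pos hφ h0))]
    exact Finset.sum_congr rfl fun h _ => reInner_matAct_pd hφ _ (hu.differentiableAt x) h0 h

end Sufficiency

/-! ### Cut-off constants with oscillating perturbations. -/

section Perturbation

variable {n m : ℕ} {φ : ℝ → ℝ} {Ω : Set (RSpace n)}
  {a : Fin n → RSpace n → Matrix (Fin m) (Fin m) ℂ}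

/-- The function `σ U₀ + p ζ`, with `σ = ρ(θ) / |U₀|`. -/
noncomputable def perturb (ρ : ℝ → ℝ) (θ : RSpace n → ℝ) (U₀ ζ : CSpace m) (p : RSpace n → ℝ)
    (x : RSpace n) : CSpace m :=
  (ρ (θ x) / ‖U₀‖) • U₀ + p x • ζ

/-- The standing requirements on a perturbation `p` of size at most `|U₀| / 2`, living where the
cutoff `θ` is `1`. -/
structure IsPerturbation (V : Set (RSpace n)) (U₀ ζ : CSpace m) (p : RSpace n → ℝ) : Prop where
  contDiff : ContDiff ℝ 1 p
  tsupport_subset : tsupport p ⊆ V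
  small : ∀ x, |p x| * ‖ζ‖ ≤ ‖U₀‖ / 2

theorem add_smul_ne_zero {U₀ ζ : CSpace m} (hU : U₀ ≠ 0) {τ : ℝ}
    (hτ : |τ| * ‖ζ‖ ≤ ‖U₀‖ / 2) : U₀ + τ • ζ ≠ 0 := by
  intro h
  have h1 : ‖U₀‖ = |τ| * ‖ζ‖ := by
    rw [eq_neg_of_add_eq_zero_left h, norm_neg, norm_smul, Real.norm_eq_abs]
  have := norm_pos_iff.2 hU
  linarith

variable {ρ : ℝ → ℝ} {θ : RSpace n → ℝ} {U₀ ζ : CSpace m} {p : RSpace n → ℝ}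
  {V : Set (RSpace n)}

theorem perturb_of_mem (hU : U₀ ≠ 0) (hρ1 : ρ 1 = ‖U₀‖) (hθV : ∀ x ∈ V, θ x = 1)
    {x : RSpace n} (hx : x ∈ V) : perturb ρ θ U₀ ζ p x = U₀ + p x • ζ := by
  rw [perturb, hθV x hx, hρ1, div_self (norm_ne_zero_iff.2 hU), one_smul]

theorem perturb_eventuallyEq_of_notMem {x : RSpace n} (hx : x ∉ tsupport p) :
    perturb ρ θ U₀ ζ p =ᶠ[𝓝 x] perturb ρ θ U₀ ζ 0 := by
  filter_upwards [(notMem_tsupport_iff_eventuallyEq.1 hx)] with y hy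
  simp [perturb, hy]

/-- On the support of `p` the function stays away from zero, where `G` is `C¹`. Off that support it
is locally `G(ρ(θ)) ρ(θ)` times a unit vector, and the profile makes this `C¹` even where `θ`
vanishes. -/
theorem isTest_radial_perturb {G : ℝ → ℝ} (hG : ContDiffOn ℝ 1 G (Ioi 0))
    (hU : U₀ ≠ 0) (hρ0 : ρ 0 = 0) (hρ1 : ρ 1 = ‖U₀‖) (hρn : ∀ τ, 0 ≤ ρ τ)
    (hρ : ContDiff ℝ 1 ρ) (hGρ : ContDiff ℝ 1 fun τ => G (ρ τ) * ρ τ)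
    (hθ : ContDiff ℝ 1 θ) (hθc : HasCompactSupport θ) (hθΩ : tsupport θ ⊆ Ω)
    (hθV : ∀ x ∈ V, θ x = 1) (hp : IsPerturbation V U₀ ζ p) :
    IsTest Ω fun x => G ‖perturb ρ θ U₀ ζ p x‖ • perturb ρ θ U₀ ζ p x := by
  have hU0 : ‖U₀‖ ≠ 0 := norm_ne_zero_iff.2 hU
  have hu : ContDiff ℝ 1 (perturb ρ θ U₀ ζ p) :=
    (((hρ.comp hθ).div_const _).smul contDiff_const).add (hp.contDiff.smul contDiff_const)
  have hsupp : Function.support (fun x => G ‖perturb ρ θ U₀ ζ p x‖ • perturb ρ θ U₀ ζ p x) ⊆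
      tsupport θ := by
    intro x hx
    by_contra hxθ
    have h1 : θ x = 0 := image_eq_zero_of_notMem_tsupport hxθ
    have h2 : x ∉ tsupport p := fun h => by
      have := hθV x (hp.tsupport_subset h)
      rw [h1] at this
      exact zero_ne_one this
    refine hx ?_
    simp [perturb, h1, hρ0, image_eq_zero_of_notMem_tsupport h2]
  refine ⟨?_, HasCompactSupport.of_support_subset_isCompact hθc hsupp,
    (closure_minimal hsupp (isClosed_tsupport θ)).trans hθΩ⟩
  rw [contDiff_iff_contDiffAt]
  intro x
  by_cases hx : x ∈ tsupport p
  · have hne : perturb ρ θ U₀ ζ p x ≠ 0 := by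
      rw [perturb_of_mem hU hρ1 hθV (hp.tsupport_subset hx)]
      exact add_smul_ne_zero hU (hp.small x)
    exact ((hG.contDiffAt (Ioi_mem_nhds (norm_pos_iff.2 hne))).comp x
      (hu.contDiffAt.norm ℂ hne)).smul hu.contDiffAt
  · have h1 : ContDiff ℝ 1 fun x => (G (ρ (θ x)) * ρ (θ x) / ‖U₀‖) • U₀ :=
      ((hGρ.comp hθ).div_const _).smul contDiff_const
    refine h1.contDiffAt.congr_of_eventuallyEq ?_
    filter_upwards [perturb_eventuallyEq_of_notMem (ρ := ρ) (θ := θ) (U₀ := U₀) (ζ := ζ) hx]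
      with y hy
    have hn : ‖(ρ (θ y) / ‖U₀‖) • U₀‖ = ρ (θ y) := by
      rw [norm_smul, Real.norm_of_nonneg (div_nonneg (hρn _) (norm_nonneg _)),
        div_mul_cancel₀ _ hU0]
    rw [hy]
    simp only [perturb, Pi.zero_apply, zero_smul, add_zero, hn, smul_smul]
    rw [mul_div_assoc]

/-- The energy density of a perturbation separates into the part carried by the perturbation and
the part of the unperturbed function. -/
theorem energy_density_perturb (hφ : AdmissiblePhi φ) (hU : U₀ ≠ 0) (hρ1 : ρ 1 = ‖U₀‖)
    (hV : IsOpen V) (hθV : ∀ x ∈ V, θ x = 1) (hp : IsPerturbation V U₀ ζ p) (x : RSpace n) :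
    ∑ h, reInner (matAct (a h x) (pd h (perturb ρ θ U₀ ζ p) x))
        (pd h (phiMul φ (perturb ρ θ U₀ ζ p)) x) =
      (∑ h, fderiv ℝ p x (EuclideanSpace.single h 1) ^ 2 *
        reInner (matAct (a h x) ζ) (radialDeriv φ (U₀ + p x • ζ) ζ)) +
      Vᶜ.indicator (fun x => ∑ h, reInner (matAct (a h x) (pd h (perturb ρ θ U₀ ζ 0) x))
        (pd h (phiMul φ (perturb ρ θ U₀ ζ 0)) x)) x := by
  by_cases hx : x ∈ V
  · rw [indicator_of_notMem (by simpa using hx), add_zero]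
    refine Finset.sum_congr rfl fun h _ => ?_
    have hev : perturb ρ θ U₀ ζ p =ᶠ[𝓝 x] fun y => U₀ + p y • ζ := by
      filter_upwards [hV.mem_nhds hx] with y hy using perturb_of_mem hU hρ1 hθV hy
    have hpd : HasFDerivAt (fun y => U₀ + p y • ζ) ((fderiv ℝ p x).smulRight ζ) x := by
      simpa using (((hp.contDiff.differentiable (by norm_num)) x).hasFDerivAt.smul_const
        ζ).const_add U₀
    have hd : HasFDerivAt (perturb ρ θ U₀ ζ p) ((fderiv ℝ p x).smulRight ζ) x :=
      hpd.congr_of_eventuallyEq hev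
    have hne : perturb ρ θ U₀ ζ p x ≠ 0 := by
      rw [hev.eq_of_nhds]; exact add_smul_ne_zero hU (hp.small x)
    have hpdu : pd h (perturb ρ θ U₀ ζ p) x = fderiv ℝ p x (EuclideanSpace.single h 1) • ζ := by
      rw [pd, hd.fderiv]; rfl
    rw [pd_phiMul hφ hd.differentiableAt hne, hpdu, hev.eq_of_nhds, matAct_smul,
      reInner_smul_left]
    simp only [radialDeriv, reInner_smul_right, reInner_add_right]
    ring
  · rw [indicator_of_mem (by simpa using hx)]
    have hx' : x ∉ tsupport p := fun h => hx (hp.tsupport_subset h)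
    have hev := perturb_eventuallyEq_of_notMem (ρ := ρ) (θ := θ) (U₀ := U₀) (ζ := ζ) hx'
    have hev2 : phiMul φ (perturb ρ θ U₀ ζ p) =ᶠ[𝓝 x] phiMul φ (perturb ρ θ U₀ ζ 0) := by
      filter_upwards [hev] with y hy
      simp only [phiMul, hy]
    have hp0 : fderiv ℝ p x = 0 := by
      by_contra hne
      exact hx' (support_fderiv_subset ℝ (Function.mem_support.2 hne))
    simp only [pd, hev.fderiv_eq, hev2.fderiv_eq, hp0, zero_apply,
      ne_eq, OfNat.ofNat_ne_zero, not_false_eq_true, zero_pow, zero_mul, Finset.sum_const_zero,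
      zero_add]

theorem abs_reInner_matAct_le (M : Matrix (Fin m) (Fin m) ℂ) (x y : CSpace m) :
    |reInner (matAct M x) y| ≤ (∑ i, ∑ j, ‖M i j‖) * (‖x‖ * ‖y‖) := by
  rw [reInner_matAct_eq_sum, Finset.sum_mul]
  refine (Finset.abs_sum_le_sum_abs _ _).trans (Finset.sum_le_sum fun i _ => ?_)
  rw [Finset.sum_mul]
  refine (Finset.abs_sum_le_sum_abs _ _).trans (Finset.sum_le_sum fun j _ => ?_)
  refine (Complex.abs_re_le_norm _).trans ?_
  rw [norm_mul, norm_mul, RCLike.norm_conj, mul_assoc]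
  gcongr
  · exact PiLp.norm_apply_le x j
  · exact PiLp.norm_apply_le y i

theorem continuousOn_radialDeriv (hφ : AdmissiblePhi φ) :
    ContinuousOn (fun q : CSpace m × CSpace m => radialDeriv φ q.1 q.2) {q | q.1 ≠ 0} := by
  have hn : ContinuousOn (fun q : CSpace m × CSpace m => ‖q.1‖) {q | q.1 ≠ 0} :=
    continuous_fst.norm.continuousOn
  have hm : MapsTo (fun q : CSpace m × CSpace m => ‖q.1‖) {q | q.1 ≠ 0} (Ioi 0) :=
    fun q hq => norm_pos_iff.2 hq
  have h1 := hφ.contDiffOn.continuousOn.comp hn hm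
  have h2 := hφ.continuousOn_deriv.comp hn hm
  exact (h1.smul continuous_snd.continuousOn).add
    (((h2.div hn fun q hq => (hm hq).ne').mul continuous_reInner.continuousOn).smul
      continuous_fst.continuousOn)

/-- The oscillating perturbation `ε ψ sin(N x_h + α)`. -/
noncomputable def sinWave (ψ : RSpace n → ℝ) (h : Fin n) (ε N α : ℝ) (x : RSpace n) : ℝ :=
  ε * (ψ x * Real.sin (N * x h + α))

theorem contDiff_sinWave {ψ : RSpace n → ℝ} (hψ : ContDiff ℝ 1 ψ) (h : Fin n) (ε N α : ℝ) :
    ContDiff ℝ 1 (sinWave ψ h ε N α) := by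
  unfold sinWave
  fun_prop

theorem tsupport_sinWave_subset (ψ : RSpace n → ℝ) (h : Fin n) (ε N α : ℝ) :
    tsupport (sinWave ψ h ε N α) ⊆ tsupport ψ := by
  refine closure_mono fun x hx => ?_
  rw [Function.mem_support] at hx ⊢
  intro h0
  exact hx (by simp [sinWave, h0])

theorem fderiv_sinWave {ψ : RSpace n → ℝ} (hψ : ContDiff ℝ 1 ψ) (h k : Fin n) (ε N α : ℝ)
    (x : RSpace n) :
    fderiv ℝ (sinWave ψ h ε N α) x (EuclideanSpace.single k 1) =
      ε * ((if k = h then N * (ψ x * Real.cos (N * x h + α)) else 0) +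
        fderiv ℝ ψ x (EuclideanSpace.single k 1) * Real.sin (N * x h + α)) := by
  have h1 : HasFDerivAt (fun x : RSpace n => x h) (EuclideanSpace.proj h : RSpace n →L[ℝ] ℝ) x :=
    (EuclideanSpace.proj h : RSpace n →L[ℝ] ℝ).hasFDerivAt
  have h2 := (((h1.const_mul N).add_const α).sin)
  have h3 := (((hψ.differentiable (by norm_num)) x).hasFDerivAt.mul h2).const_mul ε
  have h4 : HasFDerivAt (sinWave ψ h ε N α) _ x := h3
  rw [h4.fderiv]
  have hpr : (EuclideanSpace.proj h : RSpace n →L[ℝ] ℝ) (EuclideanSpace.single k 1) =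
      if k = h then 1 else 0 := by
    simp [eq_comm]
  simp only [smul_apply, add_apply, smul_eq_mul, hpr]
  split_ifs
  · ring
  · ring

end Perturbation

/-! ### Localization by oscillation and recovery of pointwise ellipticity. -/

section Necessity

variable {n m : ℕ} {φ : ℝ → ℝ} {Ω : Set (RSpace n)}
  {a : Fin n → RSpace n → Matrix (Fin m) (Fin m) ℂ}

theorem locallyIntegrableOn_reInner_matAct (hΩ : IsOpen Ω)
    (ha : ∀ h i j, LocallyIntegrableOn (fun x => a h x i j) Ω volume) (h : Fin n)
    (y z : CSpace m) :
    LocallyIntegrableOn (fun x => reInner (matAct (a h x) y) z) Ω volume := by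
  rw [locallyIntegrableOn_iff hΩ.isLocallyClosed]
  intro K hKΩ hK
  simp only [reInner_matAct_eq_sum, IntegrableOn]
  refine integrable_finsetSum _ fun i _ => integrable_finsetSum _ fun j _ => ?_
  refine Integrable.re (f := fun x => a h x i j * y j * (starRingEnd ℂ) (z i)) ?_
  have h1 : IntegrableOn (fun x => a h x i j) K volume :=
    (ha h i j).integrableOn_compact_subset hKΩ hK
  exact (h1.mul_const _).mul_const _

/-- The normalized derivative of a wave. -/
noncomputable def waveSlope (ψ : RSpace n → ℝ) (h : Fin n) (N α : ℝ) (k : Fin n)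
    (x : RSpace n) : ℝ :=
  (if k = h then ψ x * Real.cos (N * x h + α) else 0) +
    N⁻¹ * (fderiv ℝ ψ x (EuclideanSpace.single k 1) * Real.sin (N * x h + α))

theorem fderiv_sinWave_eq_waveSlope {ψ : RSpace n → ℝ} (hψ : ContDiff ℝ 1 ψ) (h k : Fin n)
    {N : ℝ} (hN : N ≠ 0) (ε α : ℝ) (x : RSpace n) :
    fderiv ℝ (sinWave ψ h ε N α) x (EuclideanSpace.single k 1) =
      ε * N * waveSlope ψ h N α k x := by
  rw [fderiv_sinWave hψ, waveSlope]
  split_ifs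
  · field_simp
  · field_simp
    ring

/-- Two phases a quarter period apart cancel the oscillation exactly, so no weak-convergence
argument is needed and pointwise limits suffice. -/
theorem waveSlope_sq_add_sq (ψ : RSpace n → ℝ) (h : Fin n) (N : ℝ) (k : Fin n) (x : RSpace n) :
    waveSlope ψ h N 0 k x ^ 2 + waveSlope ψ h N (Real.pi / 2) k x ^ 2 =
      (if k = h then ψ x ^ 2 else 0) +
        N⁻¹ ^ 2 * fderiv ℝ ψ x (EuclideanSpace.single k 1) ^ 2 := by
  have hcs := Real.sin_sq_add_cos_sq (N * x h)
  simp only [waveSlope, add_zero, Real.cos_add_pi_div_two, Real.sin_add_pi_div_two]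
  split_ifs
  · linear_combination (ψ x ^ 2 +
      N⁻¹ ^ 2 * fderiv ℝ ψ x (EuclideanSpace.single k 1) ^ 2) * hcs
  · linear_combination (N⁻¹ ^ 2 * fderiv ℝ ψ x (EuclideanSpace.single k 1) ^ 2) * hcs

theorem abs_waveSlope_le {ψ : RSpace n → ℝ} {C C' : ℝ} {x : RSpace n} (h k : Fin n)
    (hC : |ψ x| ≤ C) (hC' : |fderiv ℝ ψ x (EuclideanSpace.single k 1)| ≤ C') {N : ℝ}
    (hN : 1 ≤ N) (α : ℝ) : |waveSlope ψ h N α k x| ≤ C + C' := by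
  refine (abs_add_le _ _).trans (add_le_add ?_ ?_)
  · split_ifs
    · rw [abs_mul]
      exact (mul_le_of_le_one_right (abs_nonneg _) (Real.abs_cos_le_one _)).trans hC
    · rw [abs_zero]; exact (abs_nonneg _).trans hC
  · rw [abs_mul, abs_mul, abs_of_nonneg (inv_nonneg.2 (zero_le_one.trans hN))]
    refine (mul_le_of_le_one_left (by positivity) (inv_le_one_of_one_le₀ hN)).trans ?_
    exact (mul_le_of_le_one_right (abs_nonneg _) (Real.abs_sin_le_one _)).trans hC'

theorem RegularPhiDissipative.integral_sq_mul_nonneg (hφ : AdmissiblePhi φ) (hΩ : IsOpen Ω)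
    (ha : ∀ h i j, LocallyIntegrableOn (fun x => a h x i j) Ω volume)
    (hreg : RegularPhiDissipative φ Ω (diagTensor a)) {U₀ : CSpace m} (hU : U₀ ≠ 0)
    (ζ : CSpace m) (h₀ : Fin n) {ψ : RSpace n → ℝ} (hψ : ContDiff ℝ 1 ψ)
    (hψc : HasCompactSupport ψ) (hψΩ : tsupport ψ ⊆ Ω) :
    0 ≤ ∫ x in Ω, ψ x ^ 2 * reInner (matAct (a h₀ x) ζ) (radialDeriv φ U₀ ζ) := by
  have hU0 : 0 < ‖U₀‖ := norm_pos_iff.2 hU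
  -- Two nested compact sets: `θ` equals `1` on the inner one, a neighbourhood of the support of
  -- `ψ`, and lives in the outer one inside `Ω`.
  obtain ⟨L₂, hL₂, hψL₂, hL₂Ω⟩ := exists_compact_between hψc hΩ hψΩ
  obtain ⟨L₁, hL₁, hψL₁, hL₁L₂⟩ := exists_compact_between hψc isOpen_interior hψL₂
  obtain ⟨θ, hθ', -, hθs, hθ1⟩ := exists_contMDiff_support_eq_eq_one_iff (n := 1)
    (modelWithCornersSelf ℝ (RSpace n)) isOpen_interior hL₁.isClosed hL₁L₂
  have hθ : ContDiff ℝ 1 θ := hθ'.contDiff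
  have hθL₂ : tsupport θ ⊆ L₂ :=
    closure_minimal (by rw [hθs]; exact interior_subset) hL₂.isClosed
  have hθc : HasCompactSupport θ := hL₂.of_isClosed_subset (isClosed_tsupport θ) hθL₂
  set V := interior L₁ with hVdef
  have hV : IsOpen V := isOpen_interior
  have hθV : ∀ x ∈ V, θ x = 1 := fun x hx => (hθ1 x).1 (interior_subset hx)
  obtain ⟨ρ, hρ0, hρ1, hρn, hρ, hρφ, hρq⟩ := hφ.exists_profile hU0
  have htest : ∀ p, IsPerturbation V U₀ ζ p → IsTest Ω (perturb ρ θ U₀ ζ p) ∧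
      IsTest Ω (phiMul φ (perturb ρ θ U₀ ζ p)) ∧
      IsTest Ω (sqrtPhiMul φ (perturb ρ θ U₀ ζ p)) := by
    intro p hp
    refine ⟨?_, ?_, ?_⟩
    · have := isTest_radial_perturb (G := fun _ => 1) contDiffOn_const hU hρ0 hρ1 hρn hρ
        (by simpa using hρ) hθ hθc (hθL₂.trans hL₂Ω) hθV hp
      simpa using this
    · exact isTest_radial_perturb hφ.contDiffOn hU hρ0 hρ1 hρn hρ hρφ hθ hθc
        (hθL₂.trans hL₂Ω) hθV hp
    · exact isTest_radial_perturb (hφ.contDiffOn.sqrt fun s hs => (hφ.pos s hs).ne') hU hρ0 hρ1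
        hρn hρ hρq hθ hθc (hθL₂.trans hL₂Ω) hθV hp
  obtain ⟨C, hC⟩ := hψ.continuous.bounded_above_of_compact_support hψc
  have hC0 : 0 ≤ C := (norm_nonneg _).trans (hC 0)
  obtain ⟨C', hC'⟩ := (hψ.continuous_fderiv (by norm_num)).bounded_above_of_compact_support
    (hψc.fderiv ℝ)
  have hC'0 : 0 ≤ C' := (norm_nonneg _).trans (hC' 0)
  have hC'k : ∀ x k, |fderiv ℝ ψ x (EuclideanSpace.single k 1)| ≤ C' := by
    intro x k
    have := (fderiv ℝ ψ x).le_opNorm (EuclideanSpace.single k 1)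
    rw [PiLp.norm_single, norm_one, mul_one] at this
    exact this.trans (hC' x)
  -- The added `1` covers `ζ = 0`; for `|τ| ≤ τ₀` the vector `U₀ + τζ` stays away from the
  -- singularity at `0`.
  set τ₀ := ‖U₀‖ / (2 * (‖ζ‖ + 1)) with hτ₀
  have hτ₀pos : 0 < τ₀ := by positivity
  have hsmall : ∀ τ : ℝ, |τ| ≤ τ₀ → |τ| * ‖ζ‖ ≤ ‖U₀‖ / 2 := by
    intro τ hτ
    calc |τ| * ‖ζ‖ ≤ τ₀ * (‖ζ‖ + 1) := by gcongr; linarith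
      _ = ‖U₀‖ / 2 := by rw [hτ₀]; field_simp
  set W : ℝ → CSpace m := fun τ => radialDeriv φ (U₀ + τ • ζ) ζ with hW
  have hWc : ContinuousOn W (Icc (-τ₀) τ₀) :=
    (continuousOn_radialDeriv hφ).comp (f := fun τ : ℝ => (U₀ + τ • ζ, ζ))
      (by fun_prop : Continuous fun τ : ℝ => (U₀ + τ • ζ, ζ)).continuousOn
      fun τ hτ => add_smul_ne_zero hU (hsmall τ (abs_le.2 hτ))
  have hW0 : ContinuousAt W 0 :=
    hWc.continuousAt (Icc_mem_nhds (neg_lt_zero.2 hτ₀pos) hτ₀pos)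
  obtain ⟨CW, hCW⟩ := isCompact_Icc.exists_bound_of_continuousOn hWc
  have hCW0 : 0 ≤ CW := (norm_nonneg _).trans (hCW 0 ⟨by linarith, hτ₀pos.le⟩)
  set δ := τ₀ / (C + 1) with hδ
  have hδpos : 0 < δ := by positivity
  set r : ℕ → ℝ := fun j => (j : ℝ) + 1 with hr
  have hr1 : ∀ j, 1 ≤ r j := fun j => by simp [hr]
  have hrpos : ∀ j, 0 < r j := fun j => zero_lt_one.trans_le (hr1 j)
  have hrinv : Tendsto (fun j => (r j)⁻¹) atTop (𝓝 0) := by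
    simpa only [one_div] using tendsto_one_div_add_atTop_nhds_zero_nat (𝕜 := ℝ)
  -- Amplitude `δ / r` and frequency `r²`: the perturbation tends to zero while its gradient has
  -- order `δ r → ∞`.
  set p : ℕ → ℝ → RSpace n → ℝ := fun j α => sinWave ψ h₀ (δ / r j) (r j ^ 2) α with hp
  have hp_le : ∀ j α x, |p j α x| ≤ τ₀ * (r j)⁻¹ := by
    intro j α x
    have h1 : |ψ x * Real.sin (r j ^ 2 * x h₀ + α)| ≤ C + 1 := by
      rw [abs_mul]
      refine (mul_le_of_le_one_right (abs_nonneg _) (Real.abs_sin_le_one _)).trans ?_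
      have : |ψ x| ≤ C := hC x
      linarith
    have h2 : 0 < δ / r j := div_pos hδpos (hrpos j)
    simp only [hp, sinWave]
    rw [abs_mul, abs_of_pos h2]
    calc δ / r j * |ψ x * Real.sin (r j ^ 2 * x h₀ + α)| ≤ δ / r j * (C + 1) := by gcongr
      _ = τ₀ * (r j)⁻¹ := by rw [hδ]; have := (hrpos j).ne'; field_simp
  have hp_le' : ∀ j α x, |p j α x| ≤ τ₀ := fun j α x =>
    (hp_le j α x).trans (mul_le_of_le_one_right hτ₀pos.le (inv_le_one_of_one_le₀ (hr1 j)))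
  have hpert : ∀ j α, IsPerturbation V U₀ ζ (p j α) := fun j α =>
    ⟨contDiff_sinWave hψ _ _ _ _, (tsupport_sinWave_subset ψ _ _ _ _).trans hψL₁,
      fun x => hsmall _ (hp_le' j α x)⟩
  have hpert0 : IsPerturbation V U₀ ζ (0 : RSpace n → ℝ) :=
    ⟨contDiff_const, by simp [tsupport], fun x => by simp; positivity⟩
  set e : (RSpace n → ℝ) → RSpace n → ℝ := fun p x =>
    ∑ h, reInner (matAct (a h x) (pd h (perturb ρ θ U₀ ζ p) x))
      (pd h (phiMul φ (perturb ρ θ U₀ ζ p)) x) with he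
  have heint : ∀ p, IsPerturbation V U₀ ζ p → Integrable (e p) (volume.restrict Ω) :=
    fun p hp => (htest p hp).1.integrable_reInner_matAct_pd ha (htest p hp).2.1
  have hepos : ∀ p, IsPerturbation V U₀ ζ p → 0 ≤ ∫ x in Ω, e p x := by
    intro p hp
    have := hreg _ (htest p hp).1 (htest p hp).2.1 (htest p hp).2.2
    rwa [energy_diagTensor] at this
  -- The energy density of the cutoff region does not depend on `j`, so division by `(δ r)²` removes
  -- it in the limit.
  set E₀ := Vᶜ.indicator (e 0) with hE₀
  have hE₀int : Integrable E₀ (volume.restrict Ω) :=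
    (heint 0 hpert0).indicator hV.measurableSet.compl
  set c : ℕ → ℝ → Fin n → RSpace n → ℝ := fun j α k x => waveSlope ψ h₀ (r j ^ 2) α k x with hc
  set R : Fin n → RSpace n → ℝ → ℝ := fun k x τ => reInner (matAct (a k x) ζ) (W τ) with hR
  have hform : ∀ j α x, e (p j α) x =
      (δ * r j) ^ 2 * (∑ k, c j α k x ^ 2 * R k x (p j α x)) + E₀ x := by
    intro j α x
    have hrj := (hrpos j).ne'
    simp only [he, hE₀]
    rw [energy_density_perturb hφ hU hρ1 hV hθV (hpert j α) x, Finset.mul_sum]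
    congr 1
    refine Finset.sum_congr rfl fun k _ => ?_
    simp only [hp]
    rw [fderiv_sinWave_eq_waveSlope hψ h₀ k (pow_ne_zero 2 hrj)]
    simp only [hc, hR, hW]
    field_simp
  have hcle : ∀ j α k x, c j α k x ^ 2 ≤ (C + C') ^ 2 := by
    intro j α k x
    refine sq_le_sq' ?_ ?_
    · exact (abs_le.1 (abs_waveSlope_le h₀ k (hC x) (hC'k x k) (one_le_pow₀ (hr1 j)) α)).1
    · exact (abs_le.1 (abs_waveSlope_le h₀ k (hC x) (hC'k x k) (one_le_pow₀ (hr1 j)) α)).2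
  have hRle : ∀ k x τ, |τ| ≤ τ₀ → |R k x τ| ≤ (∑ i, ∑ j, ‖a k x i j‖) * (‖ζ‖ * CW) := by
    intro k x τ hτ
    refine (abs_reInner_matAct_le _ _ _).trans ?_
    gcongr
    exact hCW τ (abs_le.1 hτ)
  set I : ℕ → RSpace n → ℝ := fun j x =>
    (e (p j 0) x + e (p j (Real.pi / 2)) x) * ((δ * r j) ^ 2)⁻¹ with hI
  have hIform : ∀ j x, I j x = (∑ k, c j 0 k x ^ 2 * R k x (p j 0 x)) +
      (∑ k, c j (Real.pi / 2) k x ^ 2 * R k x (p j (Real.pi / 2) x)) +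
      2 * (δ ^ 2)⁻¹ * E₀ x * (r j)⁻¹ ^ 2 := by
    intro j x
    simp only [hI, hform]
    have h1 := (hrpos j).ne'
    have h2 := hδpos.ne'
    field_simp
    ring
  have hlim : Tendsto (fun j => ∫ x in Ω, I j x) atTop
      (𝓝 (∫ x in Ω, ψ x ^ 2 * R h₀ x 0)) := by
    refine tendsto_integral_of_dominated_convergence
      (fun x => (tsupport ψ).indicator (fun x => ∑ k, 2 * ((C + C') ^ 2 *
        ((∑ i, ∑ j, ‖a k x i j‖) * (‖ζ‖ * CW)))) x + |2 * (δ ^ 2)⁻¹ * E₀ x|)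
      (fun j => ?_) ?_ (fun j => ?_) ?_
    · exact (((heint _ (hpert j 0)).add (heint _ (hpert j (Real.pi / 2)))).mul_const
        _).aestronglyMeasurable
    · refine Integrable.add ?_ (hE₀int.const_mul _).abs
      refine Integrable.mono_measure ?_ (Measure.restrict_le_self (s := Ω))
      rw [integrable_indicator_iff hψc.measurableSet]
      refine integrable_finsetSum _ fun k _ => Integrable.const_mul (Integrable.const_mul
        (Integrable.mul_const ?_ _) _) _
      exact integrable_finsetSum _ fun i _ => integrable_finsetSum _ fun j _ =>
        ((ha k i j).integrableOn_compact_subset hψΩ hψc).norm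
    · refine Eventually.of_forall fun x => ?_
      rw [hIform, ← Finset.sum_add_distrib, Real.norm_eq_abs]
      refine (abs_add_le _ _).trans (add_le_add ?_ ?_)
      · by_cases hx : x ∈ tsupport ψ
        · rw [indicator_of_mem hx]
          refine (Finset.abs_sum_le_sum_abs _ _).trans (Finset.sum_le_sum fun k _ => ?_)
          refine (abs_add_le _ _).trans ?_
          rw [two_mul, abs_mul, abs_mul, abs_sq, abs_sq]
          exact add_le_add
            (mul_le_mul (hcle _ _ _ _) (hRle _ _ _ (hp_le' _ _ _)) (abs_nonneg _) (sq_nonneg _))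
            (mul_le_mul (hcle _ _ _ _) (hRle _ _ _ (hp_le' _ _ _)) (abs_nonneg _) (sq_nonneg _))
        · rw [indicator_of_notMem hx]
          have h1 : ψ x = 0 := image_eq_zero_of_notMem_tsupport hx
          have h2 : fderiv ℝ ψ x = 0 := by
            by_contra hne
            exact hx (support_fderiv_subset ℝ (Function.mem_support.2 hne))
          simp [hc, waveSlope, h1, h2]
      · rw [abs_mul, abs_of_nonneg (sq_nonneg (r j)⁻¹)]
        refine mul_le_of_le_one_right (abs_nonneg _) (pow_le_one₀ ?_ ?_)
        · exact inv_nonneg.2 (hrpos j).le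
        · exact inv_le_one_of_one_le₀ (hr1 j)
    · refine Eventually.of_forall fun x => ?_
      have hp0 : ∀ α, Tendsto (fun j => p j α x) atTop (𝓝 0) := fun α => by
        refine squeeze_zero_norm (fun j => hp_le j α x) ?_
        simpa using hrinv.const_mul τ₀
      -- Freezing the coefficient at `p = 0` costs nothing in the limit, as the slopes are bounded;
      -- only then can the two phases be combined.
      have hRlim : ∀ α k, Tendsto (fun j => c j α k x ^ 2 * (R k x (p j α x) - R k x 0)) atTop
          (𝓝 0) := by
        intro α k
        have hWlim : Tendsto (fun j => R k x (p j α x)) atTop (𝓝 (R k x 0)) := by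
          have h1 : Tendsto (fun j => W (p j α x)) atTop (𝓝 (W 0)) := hW0.tendsto.comp (hp0 α)
          simp only [hR, reInner_eq_inner_real]
          exact tendsto_const_nhds.inner h1
        have h2 : Tendsto (fun j => (C + C') ^ 2 * |R k x (p j α x) - R k x 0|) atTop (𝓝 0) := by
          simpa using ((hWlim.sub_const (R k x 0)).abs).const_mul ((C + C') ^ 2)
        refine squeeze_zero_norm (fun j => ?_) h2
        rw [norm_mul, Real.norm_eq_abs, abs_sq, Real.norm_eq_abs]
        exact mul_le_mul_of_nonneg_right (hcle j α k x) (abs_nonneg _)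
      have hsum : ∀ k, Tendsto (fun j => c j 0 k x ^ 2 * R k x (p j 0 x) +
          c j (Real.pi / 2) k x ^ 2 * R k x (p j (Real.pi / 2) x)) atTop
          (𝓝 ((if k = h₀ then ψ x ^ 2 else 0) * R k x 0)) := by
        intro k
        have hdec : Tendsto (fun j => (if k = h₀ then ψ x ^ 2 else 0) +
            (r j)⁻¹ ^ 4 * fderiv ℝ ψ x (EuclideanSpace.single k 1) ^ 2) atTop
            (𝓝 (if k = h₀ then ψ x ^ 2 else 0)) := by
          simpa using ((hrinv.pow 4).mul_const
            (fderiv ℝ ψ x (EuclideanSpace.single k 1) ^ 2)).const_add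
              (if k = h₀ then ψ x ^ 2 else 0)
        have h3 := ((hdec.mul_const (R k x 0)).add (hRlim 0 k)).add (hRlim (Real.pi / 2) k)
        simp only [add_zero] at h3
        refine h3.congr fun j => ?_
        have h4 := waveSlope_sq_add_sq ψ h₀ (r j ^ 2) k x
        simp only [hc]
        rw [show (r j)⁻¹ ^ 4 = ((r j ^ 2)⁻¹) ^ 2 by rw [← inv_pow, ← pow_mul], ← h4]
        ring
      have h5 := (tendsto_finsetSum Finset.univ fun k _ => hsum k).add
        ((hrinv.pow 2).const_mul (2 * (δ ^ 2)⁻¹ * E₀ x))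
      simp only [ite_mul, zero_mul, Finset.sum_ite_eq', Finset.mem_univ, if_true, ne_eq,
        OfNat.ofNat_ne_zero, not_false_eq_true, zero_pow, mul_zero, add_zero] at h5
      refine h5.congr fun j => ?_
      rw [hIform, Finset.sum_add_distrib]
  have hpos : ∀ j, 0 ≤ ∫ x in Ω, I j x := by
    intro j
    simp only [hI]
    rw [integral_mul_const, integral_add (heint _ (hpert j 0)) (heint _ (hpert j _))]
    exact mul_nonneg (add_nonneg (hepos _ (hpert j 0)) (hepos _ (hpert j _)))
      (inv_nonneg.2 (sq_nonneg _))
  have := ge_of_tendsto' hlim hpos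
  simpa only [hR, hW, zero_smul, add_zero] using this

/-- The inequality is a closed condition on pairs with nonzero first entry, so countably many pairs,
and hence one null set of points `x`, are enough. -/
theorem reInner_radialDeriv_nonneg_of_dense (hφ : AdmissiblePhi φ)
    (M : Matrix (Fin m) (Fin m) ℂ) {D : Set {q : CSpace m × CSpace m // q.1 ≠ 0}} (hD : Dense D)
    (h : ∀ q ∈ D, 0 ≤ reInner (matAct M q.1.2) (radialDeriv φ q.1.1 q.1.2)) {U : CSpace m}
    (hU : U ≠ 0) (ζ : CSpace m) : 0 ≤ reInner (matAct M ζ) (radialDeriv φ U ζ) := by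
  have h1 : Continuous fun q : {q : CSpace m × CSpace m // q.1 ≠ 0} =>
      radialDeriv φ q.1.1 q.1.2 :=
    (continuousOn_radialDeriv hφ).comp_continuous continuous_subtype_val fun q => q.2
  have h2 : Continuous fun q : {q : CSpace m × CSpace m // q.1 ≠ 0} => matAct M q.1.2 :=
    (continuous_matAct M).comp (continuous_snd.comp continuous_subtype_val)
  have hcont : Continuous fun q : {q : CSpace m × CSpace m // q.1 ≠ 0} =>
      reInner (matAct M q.1.2) (radialDeriv φ q.1.1 q.1.2) := by
    simp only [reInner_eq_inner_real]
    exact Continuous.inner (𝕜 := ℝ) h2 h1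
  set S := {q : {q : CSpace m × CSpace m // q.1 ≠ 0} |
    0 ≤ reInner (matAct M q.1.2) (radialDeriv φ q.1.1 q.1.2)} with hS
  have hcl : IsClosed S := isClosed_le continuous_const hcont
  have hDS : D ⊆ S := fun q hq => h q hq
  have hmem : (⟨(U, ζ), hU⟩ : {q : CSpace m × CSpace m // q.1 ≠ 0}) ∈ S :=
    closure_minimal hDS hcl (hD _)
  rwa [hS, mem_ofPred_eq] at hmem

theorem RegularPhiDissipative.diagPhiElliptic (hφ : AdmissiblePhi φ) (hΛ : LamInfSq φ < 1)
    (hΩ : IsOpen Ω) (ha : ∀ h i j, LocallyIntegrableOn (fun x => a h x i j) Ω volume)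
    {κ : ℝ} (hκ : 0 < κ) (hreg : RegularPhiDissipative φ Ω (subLaplacian (diagTensor a) κ)) :
    DiagPhiElliptic φ Ω a := by
  rw [subLaplacian_diagTensor] at hreg
  have ha' := locallyIntegrableOn_sub_smul_one ha κ
  obtain ⟨D, hDc, hD⟩ :=
    TopologicalSpace.exists_countable_dense {q : CSpace m × CSpace m // q.1 ≠ 0}
  have hae : ∀ᵐ x ∂(volume.restrict Ω), ∀ (h : Fin n), ∀ q ∈ D,
      0 ≤ reInner (matAct (a h x - (κ : ℂ) • 1) q.1.2) (radialDeriv φ q.1.1 q.1.2) := by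
    rw [ae_all_iff]
    intro h
    rw [ae_ball_iff hDc]
    intro q _
    exact ae_nonneg_of_integral_sq_mul_nonneg hΩ
      (locallyIntegrableOn_reInner_matAct hΩ ha' h _ _)
      fun ψ h1 h2 h3 => hreg.integral_sq_mul_nonneg hφ hΩ ha' q.2 q.1.2 h h1 h2 h3
  -- Nonnegativity of the form of `𝒜^h - κI` leaves `κ(|ξ|² - Λ² r²)`, and `|r| ≤ |ξ|` bounds this
  -- below by this constant times `|ξ|²`.
  refine ⟨κ * (1 - LamInfSq φ), mul_pos hκ (sub_pos.2 hΛ), hae.mono fun x hx h ξ ω t hω ht => ?_⟩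
  obtain ⟨U, ζ, hU, hUt, hUω, hξ⟩ := exists_radialDeriv_eq hφ hω ht ξ
  have hall := reInner_radialDeriv_nonneg_of_dense hφ (a h x - (κ : ℂ) • 1) hD (hx h) hU ζ
  rw [reInner_matAct_radialDeriv hφ _ hU, hUt, hUω, hξ, phiForm_sub_smul_one _ _ _ hω] at hall
  have h1 := phiForm_one_bounds (Lam φ t) hω ξ
  have h2 := hφ.Lam_sq_le ht
  have h3 : κ * ((1 - LamInfSq φ) * ‖ξ‖ ^ 2) ≤
      κ * (‖ξ‖ ^ 2 - Lam φ t ^ 2 * reInner ω ξ ^ 2) := by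
    refine mul_le_mul_of_nonneg_left (le_trans ?_ h1) hκ.le
    gcongr
  rw [mul_assoc]
  linarith

end Necessity

/-! ### The equivalences, all routed through pointwise ellipticity. -/

theorem mainTheorem3 {n m : ℕ} (hn : 2 ≤ n) (φ : ℝ → ℝ) (hφ : AdmissiblePhi φ)
    (hΛ : LamInfSq φ < 1)
    (Ω : Set (RSpace n)) (hΩ_open : IsOpen Ω) (hΩ_conn : IsConnected Ω)
    (a : Fin n → RSpace n → Matrix (Fin m) (Fin m) ℂ)
    (ha : ∀ h i j, LocallyIntegrableOn (fun x => a h x i j) Ω volume) :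
    List.TFAE
      [StrictPhiDissipative φ Ω (diagTensor a),
       ∃ κ : ℝ, 0 < κ ∧ PhiDissipative φ Ω (subLaplacian (diagTensor a) κ),
       IntegralPhiElliptic φ Ω (diagTensor a),
       WeakPhiElliptic φ Ω (diagTensor a)] ∧
    (StrongPhiElliptic φ Ω (diagTensor a) →
      StrictPhiDissipative φ Ω (diagTensor a) ∧
      (∃ κ : ℝ, 0 < κ ∧ PhiDissipative φ Ω (subLaplacian (diagTensor a) κ)) ∧
      IntegralPhiElliptic φ Ω (diagTensor a) ∧
      WeakPhiElliptic φ Ω (diagTensor a)) := by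
  refine ⟨?_, fun hs => ?_⟩
  · rw [weakPhiElliptic_iff]
    tfae_have 1 → 4 := fun ⟨κ, hκ, h⟩ =>
      (regularPhiDissipative_of_gradSq_le hφ ha hκ fun u hu hw _ => h u hu hw).diagPhiElliptic
        hφ hΛ hΩ_open ha hκ
    tfae_have 2 → 4 := fun ⟨κ, hκ, h⟩ =>
      RegularPhiDissipative.diagPhiElliptic hφ hΛ hΩ_open ha hκ fun u hu hw _ => h u hu hw
    -- The integral condition is needed only for `v = √φ(|u|) u`, where its left side is the energy
    -- of `u`; no inverse substitution of a general `v` is required.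
    tfae_have 3 → 4 := fun ⟨κ, hκ, h⟩ =>
      (regularPhiDissipative_of_gradSq_le hφ ha hκ fun u hu _ hv => by
        rw [energy_eq_integral_phiIntegrand hφ hu]
        exact h _ hv).diagPhiElliptic hφ hΛ hΩ_open ha hκ
    tfae_have 4 → 1 := fun h => h.strictPhiDissipative hφ ha
    tfae_have 4 → 2 := fun h => h.phiDissipative_subLaplacian hφ
    tfae_have 4 → 3 := fun h => h.integralPhiElliptic hφ ha
    tfae_finish
  · have h := hs.diagPhiElliptic
    exact ⟨h.strictPhiDissipative hφ ha, h.phiDissipative_subLaplacian hφ,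
      h.integralPhiElliptic hφ ha, weakPhiElliptic_iff.2 h⟩
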